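/- **Spin systems.** Let $G=(V,E)$ be a finite simple graph with maximum degree $\Delta$ and let $q$ be a positive integer. A spin system on $G$ consists of external fields $b_v\in\mathbb R_{\ge0}^q$ ($v\in V$) and symmetric interaction matrices $A_e\in\mathbb R_{\ge 0}^{q\times q}$ ($e\in E$). Its Gibbs distribution $\mu$ on $[q]^V$ is $\mu(\sigma)\propto\prod_{v\in V}b_v(\sigma_v)\prod_{e=\{u,v\}\in E}A_e(\sigma_u,\sigma_v)$. For $\Lambda\subseteq V$ and a pinning $\tau\in[q]^{V\setminus\Lambda}$, the distribution $\mu^\tau$ on $[q]^V$ is $$\mu^\tau(\sigma)\propto w^\tau(\sigma):=\mathbf 1[\sigma_{V\setminus\Lambda}=\tau]\prod_{v\in\Lambda}b_v(\sigma_v)\prod_{e=\{u,v\}\in E,\ e\cap\Lambda\ne\emptyset}A_e(\sigma_u,\sigma_v).$$ We consider only spin systems with $\sum_\sigma w^\tau(\sigma)>0$ for all $\Lambda\subseteq V$ and all $\tau\in[q]^{V\setminus\Lambda}$. **Relaxation times.** For a distribution $\nu$ on $[q]^V$ with support $\Omega(\nu)$, the Glauber dynamics on $\Omega(\nu)$ picks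 $v\in V$ uniformly at random and resamples the value at $v$ from its conditional distribution under $\nu$ given the values on $V\setminus\{v\}$. Its transition matrix has real eigenvalues $1=\lambda_1\ge\lambda_2\ge\dots\ge0$ (with multiplicity), and $T_{\mathrm{rel}}(\nu):=1/(1-\lambda_2)\in[1,\infty]$, with $1/0=\infty$, and with $\lambda_2:=0$ if $|\Omega(\nu)|=1$. For $\eta\in[0,1]$ let $D(\eta)$ be the family of all $\Lambda\subseteq V$ such that the induced subgraph $G[\Lambda]$ has maximum degree at most $\eta\Delta$, and set $$T_{\mathrm{rel}}^{(\eta)}(\mu):=\max\{T_{\mathrm{rel}}(\mu^\tau) : \Lambda\in D(\eta),\ \tau\in[q]^{V\setminus\Lambda}\}.$$ **Coupling independence.** $\mu$ is $C$-coupling independent if there is $\rho:V\to\mathbb N_{>0}$ such that for every $S\subseteq V$ and all $\sigma_1,\sigma_2\in[q]^S$ that disagree at exactly one vertex $v_0\in S$ there is a coupling $(X,Y)$ of $\mu^{\sigma_1}$ and $\mu^{\sigma_2}$ with $\mathbb E\big[\sum_{v\in V:\,X_v\ne Y_v}\rho(v)\big]\le C\,\rho(v_0)$. **Theorem (Relaxation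 Time Comparison).** There are absolute constants $c_0,c_1>0$ such that the following holds. Let $M\ge1$ and $0<\eta\le\frac1{2\lceil M\rceil}$ be real numbers and put $\Delta_0:=c_0\frac{M^2}{\eta^2}\log\frac M\eta$. For every spin system as above on a graph $G$ with maximum degree $\Delta\ge\Delta_0$, if its Gibbs distribution $\mu$ is $M$-coupling independent, then $$T_{\mathrm{rel}}(\mu)\le 2^{c_1M/\eta}\cdot T_{\mathrm{rel}}^{(\eta)}(\mu).$$ -/

import Mathlib

noncomputable section

namespace Spin

open scoped ENNReal

/-- A spin system with spins `[q] = Fin q` on the graph `G`: an external field `b_v ∈ ℝ_{≥0}^q` at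
each vertex and a symmetric interaction matrix `A_e ∈ ℝ_{≥0}^{q × q}` at each edge. (The value of
`interaction` at a pair that is not an edge of `G` is never used.) -/
structure SpinSystem {V : Type*} (G : SimpleGraph V) (q : ℕ) where
  field : V → Fin q → ℝ
  interaction : Sym2 V → Matrix (Fin q) (Fin q) ℝ
  field_nonneg : ∀ v a, 0 ≤ field v a
  interaction_nonneg : ∀ e a b, 0 ≤ interaction e a b
  interaction_symm : ∀ e, (interaction e).IsSymm

/-! ### Probability mass functions on configurations, couplings, Glauber dynamics -/

section General

variable {V : Type*} [Fintype V] {q : ℕ}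

/-- The support `Ω(μ)`. -/
abbrev Support (μ : (V → Fin q) → ℝ) : Type _ := {σ : V → Fin q // 0 < μ σ}

open Classical in
/-- The conditional probability `μ_v(a ∣ x_{V ∖ v})`. -/
def condProb (μ : (V → Fin q) → ℝ) (v : V) (x : V → Fin q) (a : Fin q) : ℝ :=
  μ (Function.update x v a) / ∑ c : Fin q, μ (Function.update x v c)

open Classical in
/-- The transition matrix of the Glauber dynamics on `Ω(μ)`: pick `v ∈ V` uniformly at random and
resample the value at `v` from `μ_v(· ∣ x_{V ∖ v})`. -/
def glauber (μ : (V → Fin q) → ℝ) : Matrix (Support μ) (Support μ) ℝ :=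
  fun x y => ∑ v : V, (Fintype.card V : ℝ)⁻¹ *
    ∑ a : Fin q, if y.1 = Function.update x.1 v a then condProb μ v x.1 a else 0

open Classical in
/-- The second largest eigenvalue, counted with multiplicity, of a real square matrix all of whose
eigenvalues are real. For a chain with a single state there is no second eigenvalue and the value
is `0` by convention (spectral gap `1`). -/
def secondEigenvalue {Ω : Type*} [Fintype Ω] (P : Matrix Ω Ω ℝ) : ℝ :=
  (P.charpoly.roots.sort (· ≥ ·)).getD 1 0

open Classical in
/-- The relaxation time `1 / (1 - λ₂)` of the Glauber dynamics; it is `∞` if `λ₂ = 1`. -/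
def relaxationTime (μ : (V → Fin q) → ℝ) : ℝ≥0∞ :=
  (ENNReal.ofReal (1 - secondEigenvalue (glauber μ)))⁻¹

open Classical in
/-- The weighted Hamming distance `H_ρ`. -/
def hamming (ρ : V → ℕ) (x y : V → Fin q) : ℝ :=
  ∑ v : V, if x v ≠ y v then (ρ v : ℝ) else 0

open Classical in
/-- `π` is the joint mass function of a coupling of `μ` and `ν`. -/
structure IsCoupling (π : (V → Fin q) → (V → Fin q) → ℝ) (μ ν : (V → Fin q) → ℝ) : Prop where
  nonneg : ∀ x y, 0 ≤ π x y
  fst : ∀ x, ∑ y, π x y = μ x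
  snd : ∀ y, ∑ x, π x y = ν y

open Classical in
/-- The expectation `E[H_ρ(X, Y)]` when `(X, Y)` has joint mass function `π`. -/
def expectedHamming (ρ : V → ℕ) (π : (V → Fin q) → (V → Fin q) → ℝ) : ℝ :=
  ∑ x, ∑ y, π x y * hamming ρ x y

end General

namespace SpinSystem

variable {V : Type*} [Fintype V] {G : SimpleGraph V} {q : ℕ}

/-- The factor `A_e(σ_v, σ_w)` of the pair `e = {v, w}`. -/
def edgeFactor (𝒮 : SpinSystem G q) (σ : V → Fin q) (e : Sym2 V) : ℝ :=
  Sym2.lift ⟨fun a b => 𝒮.interaction e a b,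
    fun a b => ((𝒮.interaction_symm e).apply b a)⟩ (e.map σ)

open Classical in
/-- The weight `w(σ) = ∏_v b_v(σ_v) ∏_{e = {v,w} ∈ E} A_e(σ_v, σ_w)`. -/
def weight (𝒮 : SpinSystem G q) (σ : V → Fin q) : ℝ :=
  (∏ v : V, 𝒮.field v (σ v)) * ∏ e ∈ G.edgeFinset, 𝒮.edgeFactor σ e

open Classical in
/-- The Gibbs distribution `μ ∝ w`. -/
def gibbs (𝒮 : SpinSystem G q) (σ : V → Fin q) : ℝ :=
  𝒮.weight σ / ∑ σ', 𝒮.weight σ'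

open Classical in
/-- The weight `w^τ` for a pinning `τ ∈ [q]^S`: configurations that disagree with `τ` on `S` have
weight `0`; only the fields outside `S` and the edges with at least one endpoint outside `S`
contribute. -/
def pinnedWeight (𝒮 : SpinSystem G q) (S : Finset V) (τ : S → Fin q) (σ : V → Fin q) : ℝ :=
  if ∀ v : S, σ v = τ v then
    (∏ v ∈ Finset.univ.filter (fun v => v ∉ S), 𝒮.field v (σ v)) *
      ∏ e ∈ G.edgeFinset.filter (fun e => ∃ v ∈ e, v ∉ S), 𝒮.edgeFactor σ e
  else 0

open Classical in
/-- The distribution `μ^τ ∝ w^τ` on `[q]^V`, for an arbitrary (feasible or not) pinning `τ`. -/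
def pinned (𝒮 : SpinSystem G q) (S : Finset V) (τ : S → Fin q) (σ : V → Fin q) : ℝ :=
  𝒮.pinnedWeight S τ σ / ∑ σ', 𝒮.pinnedWeight S τ σ'

open Classical in
/-- `∑_σ w^τ(σ) > 0` for every pinning `τ` of every vertex set, so that all the distributions
`μ^τ` (and `μ` itself, by the empty pinning) are well defined. -/
def WellDefined (𝒮 : SpinSystem G q) : Prop :=
  ∀ (S : Finset V) (τ : S → Fin q), 0 < ∑ σ, 𝒮.pinnedWeight S τ σ

/-- `C`-coupling independence. -/
def CouplingIndependent (𝒮 : SpinSystem G q) (C : ℝ) : Prop :=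
  ∃ ρ : V → ℕ, (∀ v, 0 < ρ v) ∧
    ∀ (S : Finset V) (σ₁ σ₂ : S → Fin q) (v₀ : S),
      σ₁ v₀ ≠ σ₂ v₀ → (∀ v : S, v ≠ v₀ → σ₁ v = σ₂ v) →
      ∃ π : (V → Fin q) → (V → Fin q) → ℝ,
        IsCoupling π (𝒮.pinned S σ₁) (𝒮.pinned S σ₂) ∧
        expectedHamming ρ π / (ρ v₀ : ℝ) ≤ C

end SpinSystem

open Classical in
/-- `D(η)`: the vertex sets `Λ` such that `G[Λ]` has maximum degree at most `η Δ`, where `Δ` is the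
maximum degree of `G`. -/
def lowDegreeSets {V : Type*} [Fintype V] (G : SimpleGraph V) (η : ℝ) : Set (Finset V) :=
  {Λ | ((G.induce {v | v ∈ Λ}).maxDegree : ℝ) ≤ η * (G.maxDegree : ℝ)}

open Classical in
/-- `T_rel^{(η)}(μ)`: the maximum of the relaxation times of the Glauber dynamics on `μ^τ` over all
`Λ ∈ D(η)` and all pinnings `τ ∈ [q]^{V ∖ Λ}`. -/
def SpinSystem.pinnedRelaxationTime {V : Type*} [Fintype V] {G : SimpleGraph V} {q : ℕ}
    (𝒮 : SpinSystem G q) (η : ℝ) : ℝ≥0∞ :=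
  ⨆ Λ ∈ lowDegreeSets G η, ⨆ τ : (Λᶜ : Finset V) → Fin q, relaxationTime (𝒮.pinned Λᶜ τ)

end Spin

end

noncomputable section

namespace Spin.SpinSystem

open Classical

variable {V : Type*} {G : SimpleGraph V} {q : ℕ} {𝒮 : SpinSystem G q}

theorem edgeFactor_nonneg (σ : V → Fin q) (e : Sym2 V) : 0 ≤ 𝒮.edgeFactor σ e := by
  induction e with
  | _ a b => exact 𝒮.interaction_nonneg _ _ _

theorem edgeFactor_congr {σ σ' : V → Fin q} {e : Sym2 V} (h : ∀ v ∈ e, σ v = σ' v) :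
    𝒮.edgeFactor σ e = 𝒮.edgeFactor σ' e := by
  unfold edgeFactor
  rw [Sym2.map_congr h]

variable [Fintype V]

/-- The conditional law of the whole configuration given that it agrees with `x` on `S`. -/
def kernel (𝒮 : SpinSystem G q) (S : Finset V) (x y : V → Fin q) : ℝ :=
  𝒮.pinned S (fun v => x v) y

theorem pinnedWeight_nonneg (S : Finset V) (τ : S → Fin q) (σ : V → Fin q) :
    0 ≤ 𝒮.pinnedWeight S τ σ := by
  unfold pinnedWeight
  split_ifs
  · exact mul_nonneg (Finset.prod_nonneg fun v _ => 𝒮.field_nonneg _ _)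
      (Finset.prod_nonneg fun e _ => edgeFactor_nonneg _ _)
  · exact le_rfl

theorem pinned_nonneg (S : Finset V) (τ : S → Fin q) (σ : V → Fin q) :
    0 ≤ 𝒮.pinned S τ σ :=
  div_nonneg (pinnedWeight_nonneg _ _ _) (Finset.sum_nonneg fun _ _ => pinnedWeight_nonneg _ _ _)

theorem sum_pinned (h : 𝒮.WellDefined) (S : Finset V) (τ : S → Fin q) :
    ∑ σ, 𝒮.pinned S τ σ = 1 := by
  unfold pinned
  rw [← Finset.sum_div]
  exact div_self (h S τ).ne'

theorem eq_of_pinned_ne_zero {S : Finset V} {τ : S → Fin q} {σ : V → Fin q}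
    (h : 𝒮.pinned S τ σ ≠ 0) (v : S) : σ v = τ v := by
  by_contra hv
  apply h
  unfold pinned pinnedWeight
  rw [if_neg (fun h' => hv (h' v)), zero_div]

theorem gibbs_eq_pinned (τ : (∅ : Finset V) → Fin q) : 𝒮.gibbs = 𝒮.pinned ∅ τ := by
  have hw : ∀ σ, 𝒮.weight σ = 𝒮.pinnedWeight ∅ τ σ := by
    intro σ
    unfold weight pinnedWeight
    rw [if_pos (fun v => absurd v.2 (Finset.notMem_empty _))]
    congr 1
    · simp
    · rw [Finset.filter_true_of_mem]
      intro e _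
      induction e with
      | _ a b => exact ⟨a, by simp, by simp⟩
  funext σ
  unfold gibbs pinned
  simp only [hw]

theorem kernel_nonneg (S : Finset V) (x y : V → Fin q) : 0 ≤ 𝒮.kernel S x y :=
  pinned_nonneg _ _ _

theorem sum_kernel (h : 𝒮.WellDefined) (S : Finset V) (x : V → Fin q) :
    ∑ y, 𝒮.kernel S x y = 1 :=
  sum_pinned h _ _

theorem eq_of_kernel_ne_zero {S : Finset V} {x y : V → Fin q} (h : 𝒮.kernel S x y ≠ 0) :
    ∀ v ∈ S, y v = x v :=
  fun v hv => eq_of_pinned_ne_zero h ⟨v, hv⟩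

theorem kernel_congr {S : Finset V} {x y : V → Fin q} (h : ∀ v ∈ S, x v = y v) :
    𝒮.kernel S x = 𝒮.kernel S y := by
  unfold kernel
  rw [show (fun v : S => x v) = fun v : S => y v from funext fun v => h v v.2]

/-- Releasing the vertices outside `T` after having pinned those in `S ⊆ T` changes the weight by a
factor which depends on the configuration on `T` only. -/
theorem pinnedWeight_mul_pinnedWeight_comm {S T : Finset V} (hST : S ⊆ T) (x : V → Fin q)
    {z w : V → Fin q} (hzw : ∀ v ∈ T, z v = w v) :
    𝒮.pinnedWeight S (fun v => x v) z * 𝒮.pinnedWeight T (fun v => z v) w =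
      𝒮.pinnedWeight S (fun v => x v) w * 𝒮.pinnedWeight T (fun v => w v) z := by
  have key : ∀ y : V → Fin q, (∀ v ∈ T, y v = z v) →
      𝒮.pinnedWeight S (fun v => x v) y =
        (if ∀ v : S, z v = x v then
          (∏ v ∈ Finset.univ.filter (fun v => v ∉ S ∧ v ∈ T), 𝒮.field v (z v)) *
          ∏ e ∈ G.edgeFinset.filter (fun e => (∃ v ∈ e, v ∉ S) ∧ ∀ v ∈ e, v ∈ T),
            𝒮.edgeFactor z e else 0) *
        𝒮.pinnedWeight T (fun v => z v) y := by
    intro y hy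
    unfold pinnedWeight
    rw [if_pos (fun v : T => hy v v.2)]
    have h1 : (∀ v : S, y v = x v) ↔ ∀ v : S, z v = x v :=
      forall_congr' fun v => by rw [hy v (hST v.2)]
    simp only [h1]
    split_ifs with hc
    · have e1 : (∏ v ∈ Finset.univ.filter (fun v => v ∉ S), 𝒮.field v (y v)) =
          (∏ v ∈ Finset.univ.filter (fun v => v ∉ S ∧ v ∈ T), 𝒮.field v (z v)) *
          ∏ v ∈ Finset.univ.filter (fun v => v ∉ T), 𝒮.field v (y v) := by
        rw [← Finset.prod_filter_mul_prod_filter_not _ (fun v => v ∈ T), Finset.filter_filter,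
          Finset.filter_filter]
        congr 1
        · refine Finset.prod_congr rfl fun v hv => ?_
          rw [hy v (Finset.mem_filter.1 hv).2.2]
        · refine Finset.prod_congr (Finset.filter_congr fun v _ => ?_) fun _ _ => rfl
          exact ⟨fun h => h.2, fun h => ⟨fun h' => h (hST h'), h⟩⟩
      have e2 : (∏ e ∈ G.edgeFinset.filter (fun e => ∃ v ∈ e, v ∉ S), 𝒮.edgeFactor y e) =
          (∏ e ∈ G.edgeFinset.filter (fun e => (∃ v ∈ e, v ∉ S) ∧ ∀ v ∈ e, v ∈ T),
            𝒮.edgeFactor z e) *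
          ∏ e ∈ G.edgeFinset.filter (fun e => ∃ v ∈ e, v ∉ T), 𝒮.edgeFactor y e := by
        rw [← Finset.prod_filter_mul_prod_filter_not
          (G.edgeFinset.filter (fun e => ∃ v ∈ e, v ∉ S)) (fun e => ∀ v ∈ e, v ∈ T),
          Finset.filter_filter, Finset.filter_filter]
        congr 1
        · refine Finset.prod_congr rfl fun e he => ?_
          exact edgeFactor_congr fun v hv => hy v ((Finset.mem_filter.1 he).2.2 v hv)
        · refine Finset.prod_congr (Finset.filter_congr fun e _ => ?_) fun _ _ => rfl
          push Not
          exact ⟨fun h => h.2, fun ⟨v, hv, h⟩ => ⟨⟨v, hv, fun h' => h (hST h')⟩, v, hv, h⟩⟩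
      rw [e1, e2]
      ring
    · simp
  have hT : (fun v : T => w v) = fun v : T => z v := funext fun v => (hzw v v.2).symm
  rw [hT, key z (fun _ _ => rfl), key w (fun v hv => (hzw v hv).symm)]
  ring

/-- Resampling given the configuration on `T ⊇ S` is reversible for the law pinned on `S`. -/
theorem kernel_mul_kernel_comm {S T : Finset V} (hST : S ⊆ T) (x z w : V → Fin q) :
    𝒮.kernel S x z * 𝒮.kernel T z w = 𝒮.kernel S x w * 𝒮.kernel T w z := by
  by_cases hzw : ∀ v ∈ T, z v = w v
  · have h := pinnedWeight_mul_pinnedWeight_comm (𝒮 := 𝒮) hST x hzw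
    have hT : (fun v : T => w v) = fun v : T => z v := funext fun v => (hzw v v.2).symm
    rw [hT] at h
    unfold kernel pinned
    rw [hT, div_mul_div_comm, div_mul_div_comm, h]
  · rw [show 𝒮.kernel T z w = 0 by
        by_contra h; exact hzw fun v hv => (eq_of_kernel_ne_zero h v hv).symm,
      show 𝒮.kernel T w z = 0 by
        by_contra h; exact hzw fun v hv => eq_of_kernel_ne_zero h v hv]
    simp

/-- The conditional expectation of `f` given the configuration on `S`. -/
def avg (𝒮 : SpinSystem G q) (S : Finset V) (f : (V → Fin q) → ℝ) (x : V → Fin q) : ℝ :=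
  ∑ y, 𝒮.kernel S x y * f y

/-- The conditional variance of `f` given the configuration on `S`. -/
def var (𝒮 : SpinSystem G q) (S : Finset V) (f : (V → Fin q) → ℝ) (x : V → Fin q) : ℝ :=
  𝒮.avg S (fun y => f y ^ 2) x - 𝒮.avg S f x ^ 2

theorem avg_congr {S : Finset V} {x y : V → Fin q} (h : ∀ v ∈ S, x v = y v)
    (f : (V → Fin q) → ℝ) : 𝒮.avg S f x = 𝒮.avg S f y := by
  unfold avg
  rw [kernel_congr h]

theorem avg_add (S : Finset V) (f g : (V → Fin q) → ℝ) (x : V → Fin q) :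
    𝒮.avg S (fun y => f y + g y) x = 𝒮.avg S f x + 𝒮.avg S g x := by
  simp only [avg, mul_add, Finset.sum_add_distrib]

theorem avg_sub (S : Finset V) (f g : (V → Fin q) → ℝ) (x : V → Fin q) :
    𝒮.avg S (fun y => f y - g y) x = 𝒮.avg S f x - 𝒮.avg S g x := by
  simp only [avg, mul_sub, Finset.sum_sub_distrib]

theorem avg_const_mul (S : Finset V) (c : ℝ) (f : (V → Fin q) → ℝ) (x : V → Fin q) :
    𝒮.avg S (fun y => c * f y) x = c * 𝒮.avg S f x := by
  simp only [avg, Finset.mul_sum, mul_left_comm]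

theorem avg_sum {ι : Type*} (I : Finset ι) (S : Finset V) (f : ι → (V → Fin q) → ℝ)
    (x : V → Fin q) :
    𝒮.avg S (fun y => ∑ i ∈ I, f i y) x = ∑ i ∈ I, 𝒮.avg S (f i) x := by
  simp only [avg, Finset.mul_sum]
  exact Finset.sum_comm

theorem avg_const (h : 𝒮.WellDefined) (S : Finset V) (c : ℝ) (x : V → Fin q) :
    𝒮.avg S (fun _ => c) x = c := by
  unfold avg
  rw [← Finset.sum_mul, sum_kernel h, one_mul]

theorem avg_mono (S : Finset V) {f g : (V → Fin q) → ℝ} {x : V → Fin q}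
    (hfg : ∀ y, (∀ v ∈ S, y v = x v) → f y ≤ g y) : 𝒮.avg S f x ≤ 𝒮.avg S g x := by
  refine Finset.sum_le_sum fun y _ => ?_
  by_cases hy : 𝒮.kernel S x y = 0
  · simp [hy]
  · exact mul_le_mul_of_nonneg_left (hfg y (eq_of_kernel_ne_zero hy)) (kernel_nonneg _ _ _)

theorem avg_nonneg (S : Finset V) {f : (V → Fin q) → ℝ} (x : V → Fin q) (hf : ∀ y, 0 ≤ f y) :
    0 ≤ 𝒮.avg S f x :=
  Finset.sum_nonneg fun y _ => mul_nonneg (kernel_nonneg _ _ _) (hf y)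

/-- Conditional expectations are self-adjoint. -/
theorem avg_mul_avg_comm {S T : Finset V} (hST : S ⊆ T) (f g : (V → Fin q) → ℝ)
    (x : V → Fin q) :
    𝒮.avg S (fun y => f y * 𝒮.avg T g y) x = 𝒮.avg S (fun y => 𝒮.avg T f y * g y) x := by
  simp only [avg, Finset.mul_sum, Finset.sum_mul]
  rw [Finset.sum_comm]
  refine Finset.sum_congr rfl fun z _ => Finset.sum_congr rfl fun w _ => ?_
  have := kernel_mul_kernel_comm (𝒮 := 𝒮) hST x w z
  calc _ = (𝒮.kernel S x w * 𝒮.kernel T w z) * (f w * g z) := by ring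
    _ = _ := by rw [this]; ring

theorem avg_avg (h : 𝒮.WellDefined) {S T : Finset V} (hST : S ⊆ T) (f : (V → Fin q) → ℝ)
    (x : V → Fin q) : 𝒮.avg S (𝒮.avg T f) x = 𝒮.avg S f x := by
  have := avg_mul_avg_comm (𝒮 := 𝒮) hST (fun _ => 1) f x
  simpa only [one_mul, avg_const h] using this

theorem avg_mul_of_measurable {T : Finset V} {f g : (V → Fin q) → ℝ} {x : V → Fin q}
    (hg : ∀ y, (∀ v ∈ T, y v = x v) → g y = g x) :
    𝒮.avg T (fun y => f y * g y) x = 𝒮.avg T f x * g x := by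
  unfold avg
  rw [Finset.sum_mul]
  refine Finset.sum_congr rfl fun y _ => ?_
  by_cases hy : 𝒮.kernel T x y = 0
  · simp [hy]
  · show _ * (f y * g y) = _
    rw [hg y (eq_of_kernel_ne_zero hy), mul_assoc]

theorem avg_mul_avg_self (h : 𝒮.WellDefined) {S T : Finset V} (hST : S ⊆ T)
    (f : (V → Fin q) → ℝ) (x : V → Fin q) :
    𝒮.avg S (fun y => f y * 𝒮.avg T f y) x = 𝒮.avg S (fun y => 𝒮.avg T f y ^ 2) x := by
  rw [← avg_avg h hST]
  congr 1
  funext y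
  rw [avg_mul_of_measurable fun z hz => avg_congr hz f, sq]

theorem avg_var (h : 𝒮.WellDefined) {S T : Finset V} (hST : S ⊆ T)
    (f : (V → Fin q) → ℝ) (x : V → Fin q) :
    𝒮.avg S (𝒮.var T f) x =
      𝒮.avg S (fun y => f y ^ 2) x - 𝒮.avg S (fun y => 𝒮.avg T f y ^ 2) x := by
  unfold var
  rw [avg_sub, avg_avg h hST]

theorem var_sub_const (h : 𝒮.WellDefined) (S : Finset V) (f : (V → Fin q) → ℝ) (c : ℝ) :
    𝒮.var S (fun y => f y - c) = 𝒮.var S f := by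
  funext x
  have e : (fun y => (f y - c) ^ 2) = fun y => (f y ^ 2 - (2 * c) * f y) + c ^ 2 := by
    funext y; ring
  unfold var
  rw [e, avg_add, avg_sub, avg_sub, avg_const_mul, avg_const h, avg_const h]
  ring

theorem var_nonneg (h : 𝒮.WellDefined) (S : Finset V) (f : (V → Fin q) → ℝ) (x : V → Fin q) :
    0 ≤ 𝒮.var S f x := by
  have h0 : 𝒮.var S f x = 𝒮.avg S (fun y => (f y - 𝒮.avg S f x) ^ 2) x := by
    rw [← var_sub_const h S f (𝒮.avg S f x)]
    unfold var
    rw [avg_sub, avg_const h]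
    ring
  rw [h0]
  exact avg_nonneg _ _ fun y => sq_nonneg _

end Spin.SpinSystem

end

noncomputable section

namespace Spin

open Classical

section Hamming

variable {V : Type*} [Fintype V] {q : ℕ}

theorem hamming_nonneg (ρ : V → ℕ) (x y : V → Fin q) : 0 ≤ hamming ρ x y :=
  Finset.sum_nonneg fun v _ => by split_ifs <;> positivity

theorem hamming_le_sum (ρ : V → ℕ) (x y : V → Fin q) : hamming ρ x y ≤ ∑ v, (ρ v : ℝ) :=
  Finset.sum_le_sum fun v _ => by split_ifs <;> simp

theorem one_le_hamming {ρ : V → ℕ} (hρ : ∀ v, 0 < ρ v) {x y : V → Fin q} (h : x ≠ y) :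
    1 ≤ hamming ρ x y := by
  obtain ⟨v, hv⟩ := Function.ne_iff.1 h
  have h1 : (1 : ℝ) ≤ if x v ≠ y v then (ρ v : ℝ) else 0 := by
    rw [if_pos hv]; exact_mod_cast hρ v
  exact h1.trans (Finset.single_le_sum (f := fun v => if x v ≠ y v then (ρ v : ℝ) else 0)
    (fun v _ => by split_ifs <;> positivity) (Finset.mem_univ v))

/-- `f` is `L`-Lipschitz for `H_ρ` along every set of configurations that agree on `S`. -/
def LipschitzGiven (ρ : V → ℕ) (S : Finset V) (L : ℝ) (f : (V → Fin q) → ℝ) : Prop :=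
  ∀ x y, (∀ v ∈ S, x v = y v) → f x - f y ≤ L * hamming ρ x y

theorem exists_lipschitzGiven {ρ : V → ℕ} (hρ : ∀ v, 0 < ρ v) (S : Finset V)
    (f : (V → Fin q) → ℝ) : ∃ L, 0 ≤ L ∧ LipschitzGiven ρ S L f := by
  refine ⟨2 * ∑ z, |f z|, by positivity, fun x y _ => ?_⟩
  rcases eq_or_ne x y with rfl | hxy
  · rw [sub_self]
    exact mul_nonneg (by positivity) (hamming_nonneg _ _ _)
  · have h1 : ∀ z, |f z| ≤ ∑ z, |f z| := fun z =>
      Finset.single_le_sum (f := fun z => |f z|) (fun _ _ => abs_nonneg _) (Finset.mem_univ z)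
    have h2 : f x - f y ≤ 2 * ∑ z, |f z| := by
      linarith [h1 x, h1 y, le_abs_self (f x), neg_abs_le (f y)]
    exact h2.trans (le_mul_of_one_le_right (by positivity) (one_le_hamming hρ hxy))

end Hamming

/-- Power iteration: if `s n = ‖Kⁿ f‖²` for a self-adjoint `K` grows at most like `bⁿ`, then
`s 1 ≤ b * s 0`. -/
theorem le_mul_of_sq_le_of_le_pow {s : ℕ → ℝ} {b B : ℝ} (hb : 0 < b) (hs : ∀ n, 0 ≤ s n)
    (hsq : ∀ n, s n ^ 2 ≤ s 0 * s (2 * n)) (hB : ∀ n, s n ≤ B * b ^ n) : s 1 ≤ b * s 0 := by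
  rcases (hs 0).eq_or_lt with h0 | h0
  · have := hsq 1
    rw [← h0, zero_mul] at this
    rw [← h0, mul_zero]
    nlinarith [hs 1]
  have key : ∀ j : ℕ, (s 1 / (b * s 0)) ^ (2 ^ j) ≤ s (2 ^ j) / (b ^ (2 ^ j) * s 0) := by
    intro j
    induction j with
    | zero => simp
    | succ j ih =>
      have h1 := pow_le_pow_left₀ (by have := hs 1; positivity) ih 2
      rw [← pow_mul, ← pow_succ] at h1
      refine h1.trans ?_
      rw [div_pow, div_le_div_iff₀ (by positivity) (by positivity)]
      have h2 := hsq (2 ^ j)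
      rw [← pow_succ'] at h2
      calc s (2 ^ j) ^ 2 * (b ^ 2 ^ (j + 1) * s 0)
          ≤ (s 0 * s (2 ^ (j + 1))) * (b ^ 2 ^ (j + 1) * s 0) := by gcongr
        _ = s (2 ^ (j + 1)) * (b ^ 2 ^ j * s 0) ^ 2 := by rw [pow_succ 2 j, pow_mul]; ring
  by_contra! hlt
  have hr : 1 < s 1 / (b * s 0) := (one_lt_div (by positivity)).2 hlt
  obtain ⟨n, hn⟩ := pow_unbounded_of_one_lt (B / s 0) hr
  have h3 : (s 1 / (b * s 0)) ^ n ≤ (s 1 / (b * s 0)) ^ (2 ^ n) :=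
    pow_le_pow_right₀ hr.le Nat.lt_two_pow_self.le
  have h4 : s (2 ^ n) / (b ^ (2 ^ n) * s 0) ≤ B / s 0 := by
    rw [div_le_div_iff₀ (by positivity) h0]
    calc s (2 ^ n) * s 0 ≤ (B * b ^ 2 ^ n) * s 0 := by gcongr; exact hB _
      _ = _ := by ring
  linarith [key n]

namespace SpinSystem

variable {V : Type*} [Fintype V] {G : SimpleGraph V} {q : ℕ} {𝒮 : SpinSystem G q}

/-- `C`-coupling independence with respect to the weights `ρ`. -/
def CouplingIndependentWith (𝒮 : SpinSystem G q) (ρ : V → ℕ) (C : ℝ) : Prop :=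
  (∀ v, 0 < ρ v) ∧
    ∀ (S : Finset V) (σ₁ σ₂ : S → Fin q) (v₀ : S),
      σ₁ v₀ ≠ σ₂ v₀ → (∀ v : S, v ≠ v₀ → σ₁ v = σ₂ v) →
      ∃ π : (V → Fin q) → (V → Fin q) → ℝ,
        IsCoupling π (𝒮.pinned S σ₁) (𝒮.pinned S σ₂) ∧
        expectedHamming ρ π / (ρ v₀ : ℝ) ≤ C

theorem avg_sub_avg_le_of_single {ρ : V → ℕ} {C L : ℝ} (hC : 𝒮.CouplingIndependentWith ρ C)
    {S T : Finset V} (hST : S ⊆ T) {f : (V → Fin q) → ℝ} (hL : 0 ≤ L)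
    (hf : LipschitzGiven ρ S L f) {v₀ : V} (hT : v₀ ∈ T) {x y : V → Fin q}
    (hne : x v₀ ≠ y v₀) (hS : v₀ ∉ S) (hxy : ∀ v ∈ T, v ≠ v₀ → x v = y v) :
    𝒮.avg T f x - 𝒮.avg T f y ≤ L * (C * ρ v₀) := by
  obtain ⟨π, hπ, hE⟩ := hC.2 T (fun v => x v) (fun v => y v) ⟨v₀, hT⟩ hne
    (fun v hv => hxy v v.2 fun h => hv (Subtype.ext h))
  have hρ : (0 : ℝ) < ρ v₀ := by exact_mod_cast hC.1 v₀
  rw [div_le_iff₀ hρ] at hE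
  have e1 : 𝒮.avg T f x = ∑ a, ∑ b, π a b * f a := by
    unfold avg kernel
    refine Finset.sum_congr rfl fun a _ => ?_
    rw [← hπ.fst a, Finset.sum_mul]
  have e2 : 𝒮.avg T f y = ∑ a, ∑ b, π a b * f b := by
    unfold avg kernel
    rw [Finset.sum_comm]
    refine Finset.sum_congr rfl fun b _ => ?_
    rw [← hπ.snd b, Finset.sum_mul]
  have e3 : 𝒮.avg T f x - 𝒮.avg T f y ≤ L * expectedHamming ρ π := by
    rw [e1, e2, ← Finset.sum_sub_distrib, expectedHamming, Finset.mul_sum]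
    refine Finset.sum_le_sum fun a _ => ?_
    rw [← Finset.sum_sub_distrib, Finset.mul_sum]
    refine Finset.sum_le_sum fun b _ => ?_
    rcases (hπ.nonneg a b).eq_or_lt with h0 | h0
    · simp [← h0]
    have ha : 𝒮.kernel T x a ≠ 0 := by
      have := Finset.single_le_sum (f := fun b => π a b) (fun b _ => hπ.nonneg a b)
        (Finset.mem_univ b)
      rw [hπ.fst a] at this
      exact (h0.trans_le this).ne'
    have hb : 𝒮.kernel T y b ≠ 0 := by
      have := Finset.single_le_sum (f := fun a => π a b) (fun a _ => hπ.nonneg a b)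
        (Finset.mem_univ a)
      rw [hπ.snd b] at this
      exact (h0.trans_le this).ne'
    have hab := hf a b fun v hv => by
      rw [eq_of_kernel_ne_zero ha v (hST hv), eq_of_kernel_ne_zero hb v (hST hv)]
      exact hxy v (hST hv) fun h => hS (h ▸ hv)
    calc _ = π a b * (f a - f b) := by ring
      _ ≤ π a b * (L * hamming ρ a b) := by gcongr
      _ = _ := by ring
  exact e3.trans (mul_le_mul_of_nonneg_left hE hL)

/-- Path coupling: pinning a configuration on `T` moves expectations in a Lipschitz way. -/
theorem avg_sub_avg_le {ρ : V → ℕ} {C L : ℝ} (hC : 𝒮.CouplingIndependentWith ρ C)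
    {S T : Finset V} (hST : S ⊆ T) {f : (V → Fin q) → ℝ} (hL : 0 ≤ L)
    (hf : LipschitzGiven ρ S L f) {x y : V → Fin q} (hxy : ∀ v ∈ S, x v = y v) :
    𝒮.avg T f x - 𝒮.avg T f y ≤ L * (C * ∑ v ∈ T, if x v ≠ y v then (ρ v : ℝ) else 0) := by
  have key : ∀ D : Finset V, D ⊆ T →
      𝒮.avg T f x - 𝒮.avg T f (fun v => if v ∈ D then y v else x v) ≤
        L * (C * ∑ v ∈ D, if x v ≠ y v then (ρ v : ℝ) else 0) := by
    intro D
    induction D using Finset.induction_on with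
    | empty => intro _; simp
    | insert a D ha ih =>
      intro hD
      have h1 := ih ((Finset.subset_insert a D).trans hD)
      rw [Finset.sum_insert ha]
      by_cases hne : x a = y a
      · have : (fun v => if v ∈ insert a D then y v else x v) =
            fun v => if v ∈ D then y v else x v := by
          funext v
          by_cases hv : v = a
          · subst hv; simp [ha, hne]
          · simp [hv]
        rw [this, if_neg (by simpa using hne), zero_add]
        exact h1
      · have h2 := avg_sub_avg_le_of_single hC hST hL hf (hD (Finset.mem_insert_self a D))
          (x := fun v => if v ∈ D then y v else x v)
          (y := fun v => if v ∈ insert a D then y v else x v)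
          (by simpa [ha] using hne) (fun h => hne (hxy a h))
          (fun v _ hv => by simp [hv])
        rw [if_pos hne]
        linarith
  have h := key T subset_rfl
  rwa [avg_congr (x := fun v => if v ∈ T then y v else x v) (y := y)
    (fun v hv => by simp [hv])] at h

variable {κ : Type*}

/-- The vertices outside the blocks in `I`, where the blocks are the fibres of `c`. -/
def outside (c : V → κ) (I : Finset κ) : Finset V := Finset.univ.filter fun v => c v ∉ I

theorem mem_outside {c : V → κ} {I : Finset κ} {v : V} : v ∈ outside c I ↔ c v ∉ I := by
  simp [outside]

theorem outside_subset_erase (c : V → κ) (I : Finset κ) (i : κ) :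
    outside c I ⊆ outside c (I.erase i) := fun v hv => by
  rw [mem_outside] at hv ⊢
  exact fun h => hv (Finset.mem_of_mem_erase h)

/-- The sum over the blocks in `I` of the conditional expectations given one more block. -/
def blockSum (𝒮 : SpinSystem G q) (c : V → κ) (I : Finset κ) (f : (V → Fin q) → ℝ)
    (x : V → Fin q) : ℝ :=
  ∑ i ∈ I, 𝒮.avg (outside c (I.erase i)) f x

theorem LipschitzGiven.blockSum {ρ : V → ℕ} {C L : ℝ} (hC : 𝒮.CouplingIndependentWith ρ C)
    (c : V → κ) (I : Finset κ) {f : (V → Fin q) → ℝ} (hL : 0 ≤ L) (hC0 : 0 ≤ C)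
    (hf : LipschitzGiven ρ (outside c I) L f) :
    LipschitzGiven ρ (outside c I) (L * C) (𝒮.blockSum c I f) := by
  intro x y hxy
  unfold SpinSystem.blockSum
  rw [← Finset.sum_sub_distrib]
  calc _ ≤ ∑ i ∈ I, L * (C * ∑ v ∈ outside c (I.erase i),
          if x v ≠ y v then (ρ v : ℝ) else 0) :=
        Finset.sum_le_sum fun i _ => avg_sub_avg_le hC (outside_subset_erase c I i) hL hf hxy
    _ = L * C * ∑ v, ∑ i ∈ I,
          if v ∈ outside c (I.erase i) then (if x v ≠ y v then (ρ v : ℝ) else 0) else 0 := by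
        rw [Finset.sum_comm, Finset.mul_sum]
        refine Finset.sum_congr rfl fun i _ => ?_
        rw [Finset.sum_ite_mem, Finset.univ_inter, mul_assoc]
    _ ≤ L * C * hamming ρ x y := by
        refine mul_le_mul_of_nonneg_left (Finset.sum_le_sum fun v _ => ?_) (mul_nonneg hL hC0)
        by_cases hv : x v = y v
        · simp [hv]
        · have hcv : c v ∈ I := by
            by_contra h
            exact hv (hxy v (mem_outside.2 h))
          rw [Finset.sum_eq_single (c v)]
          · split_ifs <;> simp
          · intro i _ hi
            rw [if_neg]
            rw [mem_outside, not_not]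
            exact Finset.mem_erase.2 ⟨hi.symm, hcv⟩
          · exact fun h => absurd hcv h

theorem avg_mul_blockSum_comm (c : V → κ) (I : Finset κ) (f g : (V → Fin q) → ℝ)
    (x : V → Fin q) :
    𝒮.avg (outside c I) (fun y => f y * 𝒮.blockSum c I g y) x =
      𝒮.avg (outside c I) (fun y => 𝒮.blockSum c I f y * g y) x := by
  simp only [blockSum, Finset.mul_sum, Finset.sum_mul]
  rw [avg_sum, avg_sum]
  exact Finset.sum_congr rfl fun i _ => avg_mul_avg_comm (outside_subset_erase c I i) _ _ _

theorem avg_mul_iterate_blockSum_comm (c : V → κ) (I : Finset κ) (n : ℕ)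
    (f g : (V → Fin q) → ℝ) (x : V → Fin q) :
    𝒮.avg (outside c I) (fun y => f y * (𝒮.blockSum c I)^[n] g y) x =
      𝒮.avg (outside c I) (fun y => (𝒮.blockSum c I)^[n] f y * g y) x := by
  induction n generalizing f g with
  | zero => rfl
  | succ n ih =>
    rw [Function.iterate_succ_apply, Function.iterate_succ_apply', ih, avg_mul_blockSum_comm]

theorem avg_mul_sq_le (S : Finset V) (f g : (V → Fin q) → ℝ) (x : V → Fin q) :
    𝒮.avg S (fun y => f y * g y) x ^ 2 ≤
      𝒮.avg S (fun y => f y ^ 2) x * 𝒮.avg S (fun y => g y ^ 2) x := by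
  unfold avg
  refine Finset.sum_sq_le_sum_mul_sum_of_sq_le_mul _ (fun y _ => ?_) (fun y _ => ?_)
    (fun y _ => ?_)
  · exact mul_nonneg (kernel_nonneg _ _ _) (sq_nonneg _)
  · exact mul_nonneg (kernel_nonneg _ _ _) (sq_nonneg _)
  · exact le_of_eq (by ring)

theorem sq_le_of_lipschitzGiven (h : 𝒮.WellDefined) {ρ : V → ℕ} {S : Finset V} {L : ℝ}
    (hL : 0 ≤ L) {f : (V → Fin q) → ℝ} (hf : LipschitzGiven ρ S L f) {x : V → Fin q}
    (h0 : 𝒮.avg S f x = 0) {y : V → Fin q} (hy : ∀ v ∈ S, y v = x v) :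
    f y ^ 2 ≤ (L * ∑ v, (ρ v : ℝ)) ^ 2 := by
  have hD : ∀ a b : V → Fin q, L * hamming ρ a b ≤ L * ∑ v, (ρ v : ℝ) := fun a b =>
    mul_le_mul_of_nonneg_left (hamming_le_sum _ _ _) hL
  refine sq_le_sq' ?_ ?_
  · have := avg_mono (𝒮 := 𝒮) S (f := f) (g := fun _ => f y + L * ∑ v, (ρ v : ℝ)) (x := x)
      fun z hz => by
        linarith [hf z y fun v hv => (hz v hv).trans (hy v hv).symm, hD z y]
    rw [avg_const h, h0] at this
    linarith
  · have := avg_mono (𝒮 := 𝒮) S (f := fun _ => f y - L * ∑ v, (ρ v : ℝ)) (g := f) (x := x)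
      fun z hz => by
        linarith [hf y z fun v hv => (hy v hv).trans (hz v hv).symm, hD y z]
    rw [avg_const h, h0] at this
    linarith

/-- Spectral bound for the block chain: on centred functions the sum of the conditional
expectations is bounded by the coupling constant. -/
theorem sum_avg_sq_avg_le (h : 𝒮.WellDefined) {ρ : V → ℕ} {C : ℝ} (hC0 : 0 < C)
    (hC : 𝒮.CouplingIndependentWith ρ C) (c : V → κ) (I : Finset κ) (f : (V → Fin q) → ℝ)
    {x : V → Fin q} (h0 : 𝒮.avg (outside c I) f x = 0) :
    ∑ i ∈ I, 𝒮.avg (outside c I) (fun y => 𝒮.avg (outside c (I.erase i)) f y ^ 2) x ≤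
      C * 𝒮.avg (outside c I) (fun y => f y ^ 2) x := by
  set S := outside c I with hS
  set K := 𝒮.blockSum c I with hK
  obtain ⟨L, hL, hf⟩ := exists_lipschitzGiven hC.1 S f
  have hlip : ∀ n, LipschitzGiven ρ S (L * C ^ n) (K^[n] f) := by
    intro n
    induction n with
    | zero => simpa using hf
    | succ n ih =>
      rw [Function.iterate_succ_apply', pow_succ, ← mul_assoc]
      exact LipschitzGiven.blockSum hC c I (by positivity) hC0.le ih
  have hmean : ∀ n, 𝒮.avg S (K^[n] f) x = 0 := by
    intro n
    induction n with
    | zero => exact h0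
    | succ n ih =>
      rw [Function.iterate_succ_apply']
      show 𝒮.avg S (fun y => ∑ i ∈ I, 𝒮.avg (outside c (I.erase i)) (K^[n] f) y) x = 0
      rw [avg_sum]
      exact Finset.sum_eq_zero fun i _ => by
        rw [avg_avg h (outside_subset_erase c I i)]; exact ih
  set s : ℕ → ℝ := fun n => 𝒮.avg S (fun y => K^[n] f y ^ 2) x with hs
  have hs1 : s 1 ≤ C ^ 2 * s 0 := by
    refine le_mul_of_sq_le_of_le_pow (B := (L * ∑ v, (ρ v : ℝ)) ^ 2) (by positivity)
      (fun n => avg_nonneg _ _ fun y => sq_nonneg _) (fun n => ?_) (fun n => ?_)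
    · have e : s n = 𝒮.avg S (fun y => f y * K^[2 * n] f y) x := by
        rw [two_mul, Function.iterate_add, Function.comp_def, hK, avg_mul_iterate_blockSum_comm]
        simp only [hs, sq]
        rfl
      rw [e]
      exact avg_mul_sq_le _ _ _ _
    · calc s n ≤ 𝒮.avg S (fun _ => (L * C ^ n * ∑ v, (ρ v : ℝ)) ^ 2) x :=
            avg_mono _ fun y hy =>
              sq_le_of_lipschitzGiven h (by positivity) (hlip n) (hmean n) hy
        _ = _ := by rw [avg_const h]; ring
  have hlhs : ∑ i ∈ I, 𝒮.avg S (fun y => 𝒮.avg (outside c (I.erase i)) f y ^ 2) x =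
      𝒮.avg S (fun y => f y * K f y) x := by
    simp only [hK, blockSum, Finset.mul_sum]
    rw [avg_sum]
    exact Finset.sum_congr rfl fun i _ =>
      (avg_mul_avg_self h (outside_subset_erase c I i) f x).symm
  rw [hlhs]
  have hcs := avg_mul_sq_le (𝒮 := 𝒮) S f (K f) x
  have h00 : 0 ≤ s 0 := avg_nonneg _ _ fun y => sq_nonneg _
  refine abs_le_of_sq_le_sq' (le_trans hcs ?_) (mul_nonneg hC0.le h00) |>.2
  calc s 0 * s 1 ≤ s 0 * (C ^ 2 * s 0) := by gcongr
    _ = (C * s 0) ^ 2 := by ring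

/-- Revealing one random block among at least `2 C` keeps half of the variance. -/
theorem var_le_sum_avg_var (h : 𝒮.WellDefined) {ρ : V → ℕ} {C : ℝ} (hC0 : 0 < C)
    (hC : 𝒮.CouplingIndependentWith ρ C) (c : V → κ) (I : Finset κ)
    (hI : 2 * C ≤ I.card) (f : (V → Fin q) → ℝ) (x : V → Fin q) :
    (I.card : ℝ) * 𝒮.var (outside c I) f x ≤
      2 * ∑ i ∈ I, 𝒮.avg (outside c I) (𝒮.var (outside c (I.erase i)) f) x := by
  set g : (V → Fin q) → ℝ := fun y => f y - 𝒮.avg (outside c I) f x with hg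
  have hg0 : 𝒮.avg (outside c I) g x = 0 := by
    rw [hg, avg_sub, avg_const h, sub_self]
  have hvar : ∀ T, 𝒮.var T f = 𝒮.var T g := fun T => (var_sub_const h T f _).symm
  have h1 := sum_avg_sq_avg_le h hC0 hC c I g hg0
  have h2 : 𝒮.var (outside c I) g x = 𝒮.avg (outside c I) (fun y => g y ^ 2) x := by
    rw [var, hg0]; ring
  have h3 : 0 ≤ 𝒮.avg (outside c I) (fun y => g y ^ 2) x :=
    avg_nonneg _ _ fun y => sq_nonneg _
  simp only [hvar]
  rw [h2, Finset.sum_congr rfl fun i _ => avg_var h (outside_subset_erase c I i) g x,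
    Finset.sum_sub_distrib, Finset.sum_const, nsmul_eq_mul]
  nlinarith

/-- From a Poincaré inequality when `R ≥ 2 C` blocks are free to one when more are. -/
theorem var_le_of_forall_card_eq (h : 𝒮.WellDefined) {ρ : V → ℕ} {C : ℝ} (hC0 : 0 < C)
    (hC : 𝒮.CouplingIndependentWith ρ C) (c : V → κ) {R : ℕ} (hR : 2 * C ≤ R) {T : ℝ}
    (f : (V → Fin q) → ℝ)
    (hbase : ∀ I : Finset κ, I.card = R → ∀ x, 𝒮.var (outside c I) f x ≤
      T * ∑ v ∈ (outside c I)ᶜ, 𝒮.avg (outside c I) (𝒮.var {v}ᶜ f) x)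
    (hT : 0 ≤ T) (j : ℕ) (I : Finset κ) (hI : I.card = R + j) (x : V → Fin q) :
    𝒮.var (outside c I) f x ≤
      2 ^ j * T * ∑ v ∈ (outside c I)ᶜ, 𝒮.avg (outside c I) (𝒮.var {v}ᶜ f) x := by
  induction j generalizing I x with
  | zero => simpa using hbase I hI x
  | succ j ih =>
    have hcard : (0 : ℝ) < I.card := by rw [hI]; positivity
    have h1 := var_le_sum_avg_var h hC0 hC c I
      (hR.trans (by rw [hI]; exact_mod_cast Nat.le_add_right _ _)) f x
    have h2 : ∀ i ∈ I, 𝒮.avg (outside c I) (𝒮.var (outside c (I.erase i)) f) x ≤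
        2 ^ j * T * ∑ v ∈ (outside c I)ᶜ, 𝒮.avg (outside c I) (𝒮.var {v}ᶜ f) x := by
      intro i hi
      have hsub := outside_subset_erase c I i
      calc _ ≤ 𝒮.avg (outside c I) (fun y => 2 ^ j * T * ∑ v ∈ (outside c (I.erase i))ᶜ,
              𝒮.avg (outside c (I.erase i)) (𝒮.var {v}ᶜ f) y) x :=
            avg_mono _ fun y _ => ih (I.erase i) (by rw [Finset.card_erase_of_mem hi, hI]; rfl) y
        _ = 2 ^ j * T * ∑ v ∈ (outside c (I.erase i))ᶜ,
              𝒮.avg (outside c I) (𝒮.var {v}ᶜ f) x := by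
            rw [avg_const_mul, avg_sum]
            simp only [avg_avg h hsub]
        _ ≤ _ := by
            refine mul_le_mul_of_nonneg_left ?_ (by positivity)
            exact Finset.sum_le_sum_of_subset_of_nonneg (Finset.compl_subset_compl.2 hsub)
              fun v _ _ => avg_nonneg _ _ fun y => var_nonneg h _ _ _
    have h3 := Finset.sum_le_card_nsmul I _ _ h2
    rw [nsmul_eq_mul] at h3
    refine le_of_mul_le_mul_left ?_ hcard
    rw [pow_succ]
    linarith

end SpinSystem

end Spin

end

noncomputable section

namespace Spin

open Classical

section Colouring

variable {V : Type*} [Fintype V] {G : SimpleGraph V} {k t : ℕ}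

/-- The maps `V → Fin k` such that every vertex has at most `t` neighbours of each colour in `S`. -/
def sparseColourings (G : SimpleGraph V) (k t : ℕ) (S : Finset V) : Finset (V → Fin k) :=
  Finset.univ.filter fun c =>
    ∀ v j, ((G.neighborFinset v ∩ S).filter fun w => c w = j).card ≤ t

theorem mem_sparseColourings {S : Finset V} {c : V → Fin k} : c ∈ sparseColourings G k t S ↔
    ∀ v j, ((G.neighborFinset v ∩ S).filter fun w => c w = j).card ≤ t := by
  simp [sparseColourings]

theorem sparseColourings_anti {S S' : Finset V} (h : S ⊆ S') :
    sparseColourings G k t S' ⊆ sparseColourings G k t S := fun c hc => by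
  rw [mem_sparseColourings] at hc ⊢
  exact fun v j => (Finset.card_le_card (Finset.filter_subset_filter _
    (Finset.inter_subset_inter_left h))).trans (hc v j)

theorem pow_mul_card_filter_le (S T : Finset V) {u : V} (hu : u ∉ T) :
    k ^ T.card * ((sparseColourings G k t (S \ T)).filter fun c => ∀ w ∈ T, c w = c u).card ≤
      (sparseColourings G k t (S \ T)).card := by
  have h1 : k ^ T.card = (Finset.univ : Finset (T → Fin k)).card := by simp
  rw [h1, ← Finset.card_product]
  refine Finset.card_le_card_of_injOn
    (fun p w => if hw : w ∈ T then p.1 ⟨w, hw⟩ else p.2 w) ?_ ?_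
  · rintro ⟨b, c⟩ hc
    have hc := (Finset.mem_filter.1 (Finset.mem_product.1 hc).2).1
    rw [Finset.mem_coe, mem_sparseColourings]
    rw [mem_sparseColourings] at hc
    intro v j
    refine le_trans (le_of_eq ?_) (hc v j)
    congr 1
    refine Finset.filter_congr fun w hw => ?_
    have : w ∉ T := (Finset.mem_sdiff.1 (Finset.mem_inter.1 hw).2).2
    simp [this]
  · rintro ⟨b, c⟩ hc ⟨b', c'⟩ hc' heq
    have hc := (Finset.mem_filter.1 (Finset.mem_product.1 hc).2).2
    have hc' := (Finset.mem_filter.1 (Finset.mem_product.1 hc').2).2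
    have hoff : ∀ w, w ∉ T → c w = c' w := fun w hw => by
      have := congrFun heq w
      simpa [hw] using this
    refine Prod.ext (funext fun w => ?_) (funext fun w => ?_)
    · have := congrFun heq w
      simpa using this
    · by_cases hw : w ∈ T
      · exact (hc w hw).trans ((hoff u hu).trans (hc' w hw).symm)
      · exact hoff w hw

theorem sparseColourings_sdiff_subset {S : Finset V} {u : V} (hu : u ∉ S) :
    sparseColourings G k t S \ sparseColourings G k t (insert u S) ⊆
      (G.neighborFinset u).biUnion fun v =>
        (Finset.powersetCard t (G.neighborFinset v ∩ S)).biUnion fun T =>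
          (sparseColourings G k t (S \ T)).filter fun c => ∀ w ∈ T, c w = c u := by
  intro c hc
  obtain ⟨hc, hc'⟩ := Finset.mem_sdiff.1 hc
  have hc0 := hc
  rw [mem_sparseColourings] at hc hc'
  push Not at hc'
  obtain ⟨v, j, hvj⟩ := hc'
  have huv : u ∈ G.neighborFinset v ∧ c u = j := by
    by_contra hcon
    refine absurd (hc v j) (not_le.2 (hvj.trans_le (Finset.card_le_card fun w hw => ?_)))
    simp only [Finset.mem_filter, Finset.mem_inter, Finset.mem_insert] at hw ⊢
    obtain ⟨⟨hw1, hw2⟩, hw3⟩ := hw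
    refine ⟨⟨hw1, hw2.resolve_left ?_⟩, hw3⟩
    rintro rfl
    exact hcon ⟨hw1, hw3⟩
  have hcard : t ≤ ((G.neighborFinset v ∩ S).filter fun w => c w = j).card := by
    have h1 : ((G.neighborFinset v ∩ insert u S).filter fun w => c w = j) ⊆
        insert u ((G.neighborFinset v ∩ S).filter fun w => c w = j) := by
      intro w hw
      simp only [Finset.mem_filter, Finset.mem_inter, Finset.mem_insert] at hw ⊢
      tauto
    have := (Finset.card_le_card h1).trans (Finset.card_insert_le _ _)
    omega
  obtain ⟨T, hT, hTc⟩ := Finset.exists_subset_card_eq hcard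
  simp only [Finset.mem_biUnion]
  refine ⟨v, ?_, T, Finset.mem_powersetCard.2 ⟨hT.trans (Finset.filter_subset _ _), hTc⟩, ?_⟩
  · have := huv.1
    rw [SimpleGraph.mem_neighborFinset] at this ⊢
    exact this.symm
  · refine Finset.mem_filter.2 ⟨sparseColourings_anti Finset.sdiff_subset hc0, fun w hw => ?_⟩
    rw [huv.2]
    exact (Finset.mem_filter.1 (hT hw)).2

theorem card_sparseColourings_le_two_mul (hk : 0 < k)
    (hkt : 2 * (G.maxDegree * (G.maxDegree.choose t * 2 ^ t)) ≤ k ^ t) (n : ℕ) :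
    ∀ (S : Finset V), S.card = n → ∀ u ∉ S,
      (sparseColourings G k t S).card ≤ 2 * (sparseColourings G k t (insert u S)).card := by
  induction n using Nat.strong_induction_on with
  | _ n ih =>
    intro S hS u hu
    have hremove : ∀ T, T ⊆ S → (sparseColourings G k t (S \ T)).card ≤
        2 ^ T.card * (sparseColourings G k t S).card := by
      intro T
      induction T using Finset.induction_on with
      | empty => simp
      | insert a T ha ihT =>
        intro hT
        have haS := hT (Finset.mem_insert_self a T)
        have h1 := ih _ (by
            rw [← hS]
            exact Finset.card_lt_card ⟨Finset.sdiff_subset, fun h =>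
              (Finset.mem_sdiff.1 (h haS)).2 (Finset.mem_insert_self a T)⟩)
          (S \ insert a T) rfl a (by simp)
        have h2 : insert a (S \ insert a T) = S \ T := by
          ext w
          simp only [Finset.mem_insert, Finset.mem_sdiff]
          by_cases hw : w = a
          · subst hw; simp [haS, ha]
          · simp [hw]
        rw [h2] at h1
        rw [Finset.card_insert_of_notMem ha, pow_succ]
        have := ihT ((Finset.subset_insert a T).trans hT)
        calc _ ≤ _ := h1
          _ ≤ 2 * (2 ^ T.card * (sparseColourings G k t S).card) := by gcongr
          _ = _ := by ring
    set F := (sparseColourings G k t S).card with hF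
    have hbad : k ^ t * (sparseColourings G k t S \ sparseColourings G k t (insert u S)).card ≤
        G.maxDegree * (G.maxDegree.choose t * (2 ^ t * F)) := by
      have hdeg : ∀ v, (G.neighborFinset v).card ≤ G.maxDegree := fun v => by
        rw [SimpleGraph.card_neighborFinset_eq_degree]; exact G.degree_le_maxDegree v
      refine (Nat.mul_le_mul_left _ ((Finset.card_le_card
        (sparseColourings_sdiff_subset hu)).trans Finset.card_biUnion_le)).trans ?_
      rw [Finset.mul_sum]
      refine (Finset.sum_le_card_nsmul _ _ (G.maxDegree.choose t * (2 ^ t * F))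
        fun v _ => ?_).trans ?_
      · refine (Nat.mul_le_mul_left _ Finset.card_biUnion_le).trans ?_
        rw [Finset.mul_sum]
        refine (Finset.sum_le_card_nsmul _ _ (2 ^ t * F) fun T hT => ?_).trans ?_
        · obtain ⟨hTS, hTc⟩ := Finset.mem_powersetCard.1 hT
          have hTS := hTS.trans Finset.inter_subset_right
          have h1 := pow_mul_card_filter_le (G := G) (k := k) (t := t) S T
            (fun h => hu (hTS h))
          have h2 := hremove T hTS
          rw [hTc] at h1 h2
          exact h1.trans h2
        · rw [Finset.card_powersetCard, smul_eq_mul]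
          refine Nat.mul_le_mul_right _ (Nat.choose_le_choose _ ?_)
          exact (Finset.card_le_card Finset.inter_subset_left).trans (hdeg v)
      · rw [smul_eq_mul]
        exact Nat.mul_le_mul_right _ (hdeg u)
    have hsplit := Finset.card_sdiff_add_card_eq_card
      (sparseColourings_anti (G := G) (k := k) (t := t) (Finset.subset_insert u S))
    set A := (sparseColourings G k t S \ sparseColourings G k t (insert u S)).card
    have h3 : k ^ t * (2 * A) ≤ k ^ t * F := by
      calc _ = 2 * (k ^ t * A) := by ring
        _ ≤ 2 * (G.maxDegree * (G.maxDegree.choose t * (2 ^ t * F))) := by gcongr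
        _ = 2 * (G.maxDegree * (G.maxDegree.choose t * 2 ^ t)) * F := by ring
        _ ≤ _ := by gcongr
    have h4 := Nat.le_of_mul_le_mul_left h3 (by positivity)
    omega

/-- Every graph of large degree has a vertex partition into `k` parts in which every vertex has at
most `t` neighbours in each part. -/
theorem exists_sparseColouring (hk : 0 < k)
    (hkt : 2 * (G.maxDegree * (G.maxDegree.choose t * 2 ^ t)) ≤ k ^ t) :
    ∃ c : V → Fin k, ∀ v j, ((G.neighborFinset v).filter fun w => c w = j).card ≤ t := by
  have hpos : ∀ S : Finset V, 0 < (sparseColourings G k t S).card := by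
    intro S
    induction S using Finset.induction_on with
    | empty =>
      refine Finset.card_pos.2 ⟨fun _ => ⟨0, hk⟩, ?_⟩
      rw [mem_sparseColourings]
      simp
    | insert u S hu ih =>
      have := card_sparseColourings_le_two_mul hk hkt _ S rfl u hu
      omega
  obtain ⟨c, hc⟩ := Finset.card_pos.1 (hpos Finset.univ)
  rw [mem_sparseColourings] at hc
  exact ⟨c, by simpa using hc⟩

end Colouring

theorem sixteen_mul_sq_le_two_pow {t : ℕ} (ht : 11 ≤ t) : 16 * t ^ 2 ≤ 2 ^ t := by
  induction t, ht using Nat.le_induction with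
  | base => norm_num
  | succ t ht ih => rw [pow_succ 2 t]; nlinarith

theorem choose_mul_two_pow_le (n : ℕ) {t : ℕ} (ht : 0 < t) :
    (n.choose t * 2 ^ t : ℝ) ≤ (6 * n / t) ^ t := by
  have h1 : (t : ℝ) ^ t ≤ 3 ^ t * t.factorial := by
    have h := Real.pow_div_factorial_le_exp (t : ℝ) (Nat.cast_nonneg t) t
    rw [div_le_iff₀ (by positivity)] at h
    refine h.trans ?_
    gcongr
    rw [← mul_one (t : ℝ), Real.exp_nat_mul]
    gcongr
    exact Real.exp_one_lt_three.le
  have h2 : (n.choose t : ℝ) ≤ (n : ℝ) ^ t / t.factorial := Nat.choose_le_pow_div t n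
  rw [div_pow, le_div_iff₀ (by positivity)]
  calc (n.choose t * 2 ^ t * t ^ t : ℝ)
      ≤ (n ^ t / t.factorial) * 2 ^ t * (3 ^ t * t.factorial) := by gcongr
    _ = (6 * n) ^ t := by
        rw [mul_pow, show (6 : ℝ) = 2 * 3 by norm_num, mul_pow]
        field_simp

theorem exists_partition_parameters {M η : ℝ} (hM : 1 ≤ M) (hη : 0 < η)
    (hηM : η ≤ 1 / (2 * (⌈M⌉ : ℝ))) {n : ℕ}
    (hn : 200 * (M ^ 2 / η ^ 2 * Real.log (M / η)) ≤ n) :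
    ∃ k t R : ℕ, 2 * (n * (n.choose t * 2 ^ t)) ≤ k ^ t ∧ 0 < k ∧ 2 * M ≤ R ∧ R ≤ k ∧
      (R * t : ℝ) ≤ η * n ∧ (k : ℝ) ≤ 100 * (M / η) := by
  have hceil : M ≤ ⌈M⌉ := Int.le_ceil M
  have hceil' : (⌈M⌉ : ℝ) < M + 1 := Int.ceil_lt_add_one M
  have hη1 : η ≤ 1 / 2 := hηM.trans (by
    rw [div_le_div_iff₀ (by linarith) (by norm_num)]; linarith)
  set a := M / η with ha
  have haη : a * η = M := by rw [ha]; field_simp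
  have ha2 : 2 ≤ a := by rw [ha, le_div_iff₀ hη]; linarith
  have hlog : (1 : ℝ) / 2 ≤ Real.log a := by
    have h1 := Real.log_two_gt_d9
    have h2 := Real.log_le_log (by norm_num) ha2
    linarith
  have hn' : 100 * a ^ 2 ≤ n := by
    have : M ^ 2 / η ^ 2 = a ^ 2 := by rw [ha, div_pow]
    rw [this] at hn
    nlinarith [sq_nonneg a]
  set R := 2 * ⌈M⌉₊ with hR
  have hRM : 2 * M ≤ R := by
    rw [hR]; push_cast; linarith [Nat.le_ceil M]
  have hRM' : (R : ℝ) ≤ 4 * M := by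
    rw [hR]; push_cast; linarith [Nat.ceil_lt_add_one (by linarith : (0 : ℝ) ≤ M)]
  have hR0 : (0 : ℝ) < R := by linarith
  set X := η * n / R with hX
  have hXR : X * R = η * n := by rw [hX]; field_simp
  have hXa : (n : ℝ) ≤ 4 * a * X := by
    have h1 : M * n ≤ M * (4 * a * X) := by
      calc M * n = a * (η * n) := by rw [← haη]; ring
        _ = a * (X * R) := by rw [hXR]
        _ ≤ a * (X * (4 * M)) := by
            have : 0 ≤ X := by positivity
            gcongr
        _ = _ := by ring
    exact le_of_mul_le_mul_left h1 (by linarith)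
  have hX1 : 25 * a ≤ X := by
    have : a * (25 * a) ≤ a * X := by nlinarith
    exact le_of_mul_le_mul_left this (by linarith)
  set t := ⌊X⌋₊ with ht
  have htX : (t : ℝ) ≤ X := Nat.floor_le (by linarith)
  have htX' : X / 2 ≤ t := by
    have := Nat.lt_floor_add_one X
    rw [← ht] at this
    linarith
  have hta : a ≤ t := by linarith
  have ht11 : 11 ≤ t := by
    have : (11 : ℝ) ≤ t := by linarith
    exact_mod_cast this
  have ht0 : (0 : ℝ) < t := by linarith
  set k := ⌈24 * R / η⌉₊ with hk
  have hkR : 24 * R / η ≤ k := Nat.le_ceil _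
  have hkR' : (k : ℝ) < 24 * R / η + 1 := Nat.ceil_lt_add_one (by positivity)
  rw [div_le_iff₀ hη] at hkR
  have hRk : (R : ℝ) ≤ k := by
    have : (k : ℝ) * η ≤ k * 1 := by gcongr; linarith
    linarith
  refine ⟨k, t, R, ?_, ?_, hRM, by exact_mod_cast hRk, ?_, ?_⟩
  · have h1 : (2 * n : ℝ) ≤ 2 ^ t := by
      have h2 : (16 * t ^ 2 : ℝ) ≤ 2 ^ t := by exact_mod_cast sixteen_mul_sq_le_two_pow ht11
      nlinarith
    have h2 : (6 * n / t : ℝ) ≤ k / 2 := by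
      rw [div_le_div_iff₀ ht0 (by norm_num)]
      have h3 : (R * η) * (12 * n) ≤ (R * η) * (k * t) := by
        calc (R * η) * (12 * n) = 12 * R * (X * R) := by rw [hXR]; ring
          _ ≤ 12 * R * ((2 * t) * R) := by gcongr; linarith
          _ = (24 * R) * (R * t) := by ring
          _ ≤ (k * η) * (R * t) := by gcongr
          _ = _ := by ring
      have := le_of_mul_le_mul_left h3 (by positivity)
      linarith
    have h3 : (2 * (n * (n.choose t * 2 ^ t)) : ℝ) ≤ k ^ t := by
      calc (2 * (n * (n.choose t * 2 ^ t)) : ℝ) = (2 * n) * (n.choose t * 2 ^ t) := by ring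
        _ ≤ 2 ^ t * (k / 2) ^ t := by
            gcongr
            exact (choose_mul_two_pow_le n (by omega)).trans (by gcongr)
        _ = k ^ t := by rw [← mul_pow]; congr 1; ring
    exact_mod_cast h3
  · have : (0 : ℝ) < k := by linarith
    exact_mod_cast this
  · calc (R * t : ℝ) ≤ R * X := by gcongr
      _ = _ := by rw [mul_comm, hXR]
  · have : 24 * R / η ≤ 96 * a := by
      rw [div_le_iff₀ hη]
      nlinarith
    linarith

end Spin

end

noncomputable section

set_option linter.unusedSectionVars false

section SecondEigenvalue

variable {E : Type*} [NormedAddCommGroup E] [InnerProductSpace ℝ E] [FiniteDimensional ℝ E]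
  {n : ℕ} {T : E →ₗ[ℝ] E}

open scoped InnerProductSpace

theorem LinearMap.IsSymmetric.inner_apply_self_eq_sum (hT : T.IsSymmetric)
    (hn : Module.finrank ℝ E = n) (g : E) :
    ⟪T g, g⟫_ℝ = ∑ j, hT.eigenvalues hn j * ⟪hT.eigenvectorBasis hn j, g⟫_ℝ ^ 2 := by
  rw [← (hT.eigenvectorBasis hn).sum_inner_mul_inner]
  refine Finset.sum_congr rfl fun j _ => ?_
  rw [hT g, hT.apply_eigenvectorBasis, real_inner_comm, inner_smul_left, conj_trivial]
  exact (mul_assoc _ _ _).trans (congrArg _ (sq _).symm)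

theorem OrthonormalBasis.inner_self_eq_sum {ι : Type*} [Fintype ι] (b : OrthonormalBasis ι ℝ E)
    (g : E) : ⟪g, g⟫_ℝ = ∑ j, ⟪b j, g⟫_ℝ ^ 2 := by
  rw [← b.sum_inner_mul_inner]
  refine Finset.sum_congr rfl fun j _ => ?_
  rw [real_inner_comm, sq]

/-- The quadratic form on the complement of a top eigenvector is at most the second eigenvalue. -/
theorem LinearMap.IsSymmetric.inner_apply_self_le_second (hT : T.IsSymmetric)
    (hn : Module.finrank ℝ E = n) (h1 : 1 < n) {w : E} (hw : w ≠ 0) {θ : ℝ}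
    (hTw : T w = θ • w) (hθ : ∀ g, ⟪T g, g⟫_ℝ ≤ θ * ⟪g, g⟫_ℝ) {g : E} (hg : ⟪w, g⟫_ℝ = 0) :
    ⟪T g, g⟫_ℝ ≤ hT.eigenvalues hn ⟨1, h1⟩ * ⟪g, g⟫_ℝ := by
  rcases le_or_gt θ (hT.eigenvalues hn ⟨1, h1⟩) with hle | hlt
  · exact (hθ g).trans (mul_le_mul_of_nonneg_right hle real_inner_self_nonneg)
  set b := hT.eigenvectorBasis hn with hb
  have hle : ∀ j : Fin n, j ≠ ⟨0, by omega⟩ →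
      hT.eigenvalues hn j ≤ hT.eigenvalues hn ⟨1, h1⟩ := fun j hj =>
    hT.eigenvalues_antitone hn (by
      rw [Fin.le_def]
      exact Nat.one_le_iff_ne_zero.2 fun h => hj (Fin.ext h))
  have hbw : ∀ j : Fin n, j ≠ ⟨0, by omega⟩ → ⟪w, b j⟫_ℝ = 0 := by
    intro j hj
    have h := hT w (b j)
    rw [hTw, hb, hT.apply_eigenvectorBasis, inner_smul_left, inner_smul_right] at h
    have h' : (θ - hT.eigenvalues hn j) * ⟪w, b j⟫_ℝ = 0 :=
      (sub_mul _ _ _).trans (sub_eq_zero.2 h)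
    exact (mul_eq_zero.1 h').resolve_left (by linarith [hle j hj])
  have hsum : ∀ g' : E, ⟪w, g'⟫_ℝ = ⟪w, b ⟨0, by omega⟩⟫_ℝ * ⟪b ⟨0, by omega⟩, g'⟫_ℝ := by
    intro g'
    rw [← b.sum_inner_mul_inner, Finset.sum_eq_single ⟨0, by omega⟩]
    · intro j _ hj
      rw [hbw j hj, zero_mul]
    · exact fun h => absurd (Finset.mem_univ _) h
  have hg0 : ⟪b ⟨0, by omega⟩, g⟫_ℝ = 0 := by
    have h := hsum g
    rw [hg] at h
    refine (mul_eq_zero.1 h.symm).resolve_left fun h0 => hw ?_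
    rw [← inner_self_eq_zero (𝕜 := ℝ), hsum w, h0, zero_mul]
  rw [hT.inner_apply_self_eq_sum hn, b.inner_self_eq_sum, Finset.mul_sum]
  refine Finset.sum_le_sum fun j _ => ?_
  by_cases hj : j = ⟨0, by omega⟩
  · rw [hj, ← hb, hg0]; simp
  · exact mul_le_mul_of_nonneg_right (hle j hj) (sq_nonneg _)

/-- A bound of the quadratic form on a hyperplane is a bound of the second eigenvalue. -/
theorem LinearMap.IsSymmetric.second_eigenvalue_le (hT : T.IsSymmetric)
    (hn : Module.finrank ℝ E = n) (h1 : 1 < n) {w : E} {κ : ℝ}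
    (hκ : ∀ g, ⟪w, g⟫_ℝ = 0 → ⟪T g, g⟫_ℝ ≤ κ * ⟪g, g⟫_ℝ) :
    hT.eigenvalues hn ⟨1, h1⟩ ≤ κ := by
  set b := hT.eigenvectorBasis hn with hb
  set u := b ⟨0, by omega⟩ with hu
  set v := b ⟨1, h1⟩ with hv
  have huu : ⟪u, u⟫_ℝ = 1 := by rw [real_inner_self_eq_norm_sq, b.norm_eq_one]; norm_num
  have hvv : ⟪v, v⟫_ℝ = 1 := by rw [real_inner_self_eq_norm_sq, b.norm_eq_one]; norm_num
  have huv : ⟪u, v⟫_ℝ = 0 := b.inner_eq_zero (by simp)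
  have hvu : ⟪v, u⟫_ℝ = 0 := b.inner_eq_zero (by simp)
  have hTu : T u = hT.eigenvalues hn ⟨0, by omega⟩ • u := hT.apply_eigenvectorBasis hn _
  have hTv : T v = hT.eigenvalues hn ⟨1, h1⟩ • v := hT.apply_eigenvectorBasis hn _
  have hle : hT.eigenvalues hn ⟨1, h1⟩ ≤ hT.eigenvalues hn ⟨0, by omega⟩ :=
    hT.eigenvalues_antitone hn (by simp [Fin.le_def])
  set l₀ := hT.eigenvalues hn ⟨0, by omega⟩
  set l₁ := hT.eigenvalues hn ⟨1, h1⟩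
  by_cases hwv : ⟪w, v⟫_ℝ = 0
  · have := hκ v hwv
    rw [hTv, inner_smul_left, hvv] at this
    simpa using this
  · have h := hκ (⟪w, v⟫_ℝ • u - ⟪w, u⟫_ℝ • v) (by
      rw [inner_sub_right, inner_smul_right, inner_smul_right]; ring)
    simp only [map_sub, map_smul, hTu, hTv, inner_sub_left, inner_sub_right, inner_smul_left,
      inner_smul_right, huu, hvv, huv, hvu, conj_trivial] at h
    have hpos : 0 < ⟪w, v⟫_ℝ ^ 2 + ⟪w, u⟫_ℝ ^ 2 := by positivity
    refine le_of_mul_le_mul_right ?_ hpos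
    nlinarith [sq_nonneg ⟪w, v⟫_ℝ]

end SecondEigenvalue

namespace Spin

open Classical
open scoped InnerProductSpace

section Reversible

variable {Ω : Type*} [Fintype Ω] {P : Matrix Ω Ω ℝ} {s : Ω → ℝ}

theorem secondEigenvalue_eq_of_card_le (h : Fintype.card Ω ≤ 1) : secondEigenvalue P = 0 := by
  unfold secondEigenvalue
  refine List.getD_eq_default _ _ ?_
  rw [Multiset.length_sort]
  refine (Polynomial.card_roots' _).trans ?_
  rwa [Matrix.charpoly_natDegree_eq_dim]

/-- The symmetrization of a matrix that is reversible with respect to the weights `s²`. -/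
def symmetrize (P : Matrix Ω Ω ℝ) (s : Ω → ℝ) : Matrix Ω Ω ℝ :=
  Matrix.of fun x y => s x * P x y * (s y)⁻¹

theorem symmetrize_isHermitian (hs : ∀ x, 0 < s x)
    (hrev : ∀ x y, s x ^ 2 * P x y = s y ^ 2 * P y x) : (symmetrize P s).IsHermitian := by
  ext x y
  have hx := (hs x).ne'
  have hy := (hs y).ne'
  have := hrev x y
  simp only [symmetrize, Matrix.conjTranspose_apply, Matrix.of_apply, star_trivial]
  field_simp
  linarith

theorem charpoly_symmetrize (hs : ∀ x, 0 < s x) :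
    (symmetrize P s).charpoly = P.charpoly := by
  have e : symmetrize P s = Matrix.diagonal s * (P * Matrix.diagonal fun x => (s x)⁻¹) := by
    ext x y
    simp [symmetrize, Matrix.diagonal_mul, Matrix.mul_diagonal, mul_assoc]
  have e' : P * (Matrix.diagonal fun x => (s x)⁻¹) * Matrix.diagonal s = P := by
    rw [mul_assoc, Matrix.diagonal_mul_diagonal]
    have : (fun x => (s x)⁻¹ * s x) = fun _ => (1 : ℝ) :=
      funext fun x => inv_mul_cancel₀ (hs x).ne'
    rw [this, Matrix.diagonal_one, mul_one]
  rw [e, Matrix.charpoly_mul_comm, e']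

theorem secondEigenvalue_eq_eigenvalues {A : Matrix Ω Ω ℝ} (hA : A.IsHermitian)
    (hPA : A.charpoly = P.charpoly) (h : 1 < Fintype.card Ω) :
    secondEigenvalue P =
      (Matrix.isSymmetric_toEuclideanLin_iff.mpr hA).eigenvalues finrank_euclideanSpace ⟨1, h⟩ := by
  have h1 := hA.sort_roots_charpoly_eq_eigenvalues₀
  have h2 : A.charpoly.roots.map RCLike.re = A.charpoly.roots := by
    simp
  rw [h2, hPA] at h1
  unfold secondEigenvalue
  rw [h1, List.getD_eq_getElem _ _ (by simpa using h)]
  simp [Matrix.IsHermitian.eigenvalues₀]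

theorem inner_toLp_mul (f g : Ω → ℝ) :
    ⟪WithLp.toLp 2 (fun x => s x * f x), WithLp.toLp 2 (fun x => s x * g x)⟫_ℝ =
      ∑ x, s x ^ 2 * (f x * g x) := by
  rw [PiLp.inner_apply]
  refine Finset.sum_congr rfl fun x _ => ?_
  simp
  ring

theorem toEuclideanLin_symmetrize_apply (hs : ∀ x, 0 < s x) (f : Ω → ℝ) :
    Matrix.toEuclideanLin (symmetrize P s) (WithLp.toLp 2 fun x => s x * f x) =
      WithLp.toLp 2 fun x => s x * ∑ y, P x y * f y := by
  rw [Matrix.toLpLin_apply]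
  congr 1
  funext x
  simp only [Matrix.mulVec, dotProduct, symmetrize, Matrix.of_apply, Finset.mul_sum]
  refine Finset.sum_congr rfl fun y _ => ?_
  have := (hs y).ne'
  field_simp

theorem exists_toLp_mul_eq (hs : ∀ x, 0 < s x) (g : EuclideanSpace ℝ Ω) :
    ∃ f : Ω → ℝ, g = WithLp.toLp 2 fun x => s x * f x :=
  ⟨fun x => (s x)⁻¹ * g x, PiLp.ext fun x => by
    have := (hs x).ne'
    simp only [mul_inv_cancel_left₀ this]⟩

/-- The Poincaré inequality with constant `1 - λ₂` for a reversible chain. -/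
theorem one_sub_secondEigenvalue_mul_le (hs : ∀ x, 0 < s x)
    (hrev : ∀ x y, s x ^ 2 * P x y = s y ^ 2 * P y x) (hrow : ∀ x, ∑ y, P x y = 1)
    (hpos : ∀ f : Ω → ℝ, 0 ≤ ∑ x, s x ^ 2 * (f x * (f x - ∑ y, P x y * f y)))
    {f : Ω → ℝ} (hf : ∑ x, s x ^ 2 * f x = 0) :
    (1 - secondEigenvalue P) * ∑ x, s x ^ 2 * f x ^ 2 ≤
      ∑ x, s x ^ 2 * (f x * (f x - ∑ y, P x y * f y)) := by
  by_cases h : 1 < Fintype.card Ω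
  · have hA := symmetrize_isHermitian hs hrev
    have hT := Matrix.isSymmetric_toEuclideanLin_iff.mpr hA
    have hquad : ∀ f : Ω → ℝ, ∑ x, s x ^ 2 * (f x * (f x - ∑ y, P x y * f y)) =
        ∑ x, s x ^ 2 * (f x * f x) - ∑ x, s x ^ 2 * ((∑ y, P x y * f y) * f x) := fun f => by
      rw [← Finset.sum_sub_distrib]
      exact Finset.sum_congr rfl fun x _ => by ring
    have hne : Nonempty Ω := Fintype.card_pos_iff.1 (by omega)
    have key := hT.inner_apply_self_le_second finrank_euclideanSpace h
      (w := WithLp.toLp 2 fun x => s x * 1) (θ := 1) ?_ ?_ ?_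
      (g := WithLp.toLp 2 fun x => s x * f x) ?_
    · rw [toEuclideanLin_symmetrize_apply hs, inner_toLp_mul, inner_toLp_mul,
        ← secondEigenvalue_eq_eigenvalues hA (charpoly_symmetrize hs) h] at key
      rw [hquad]
      simp only [sq (f _)]
      linarith
    · intro h0
      obtain ⟨x⟩ := hne
      have := congrArg (fun g : EuclideanSpace ℝ Ω => g x) h0
      simp at this
      exact (hs x).ne' this
    · rw [toEuclideanLin_symmetrize_apply hs (fun _ => 1), one_smul]
      simp [hrow]
    · intro g
      obtain ⟨f, rfl⟩ := exists_toLp_mul_eq hs g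
      rw [toEuclideanLin_symmetrize_apply hs, inner_toLp_mul, inner_toLp_mul]
      linarith [hpos f, hquad f]
    · rw [inner_toLp_mul (fun _ => 1) f]
      simpa using hf
  · have hsub : Subsingleton Ω := Fintype.card_le_one_iff_subsingleton.1 (not_lt.1 h)
    have hf0 : ∀ x, f x = 0 := fun x => by
      rw [Fintype.sum_subsingleton _ x] at hf
      exact (mul_eq_zero.1 hf).resolve_left (by have := hs x; positivity)
    simp [hf0]

/-- A Poincaré inequality bounds the second eigenvalue of a reversible chain. -/
theorem secondEigenvalue_le (hs : ∀ x, 0 < s x)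
    (hrev : ∀ x y, s x ^ 2 * P x y = s y ^ 2 * P y x) {κ : ℝ} (hκ0 : 0 ≤ κ)
    (hκ : ∀ f : Ω → ℝ, ∑ x, s x ^ 2 * f x = 0 →
      ∑ x, s x ^ 2 * (f x * ∑ y, P x y * f y) ≤ κ * ∑ x, s x ^ 2 * f x ^ 2) :
    secondEigenvalue P ≤ κ := by
  by_cases h : 1 < Fintype.card Ω
  · have hA := symmetrize_isHermitian hs hrev
    have hT := Matrix.isSymmetric_toEuclideanLin_iff.mpr hA
    rw [secondEigenvalue_eq_eigenvalues hA (charpoly_symmetrize hs) h]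
    refine hT.second_eigenvalue_le finrank_euclideanSpace h
      (w := WithLp.toLp 2 fun x => s x * 1) fun g hg => ?_
    obtain ⟨f, rfl⟩ := exists_toLp_mul_eq hs g
    rw [inner_toLp_mul (fun _ => 1) f] at hg
    rw [toEuclideanLin_symmetrize_apply hs, inner_toLp_mul, inner_toLp_mul]
    have := hκ f (by simpa using hg)
    simpa only [sq (f _), mul_comm (∑ y, _) (f _)] using this
  · rwa [secondEigenvalue_eq_of_card_le (not_lt.1 h)]

end Reversible

section Glauber

variable {V : Type*} [Fintype V] {q : ℕ} {ν : (V → Fin q) → ℝ}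

/-- One step of the Glauber dynamics applied to a function. -/
def glauberAvg (ν : (V → Fin q) → ℝ) (f : (V → Fin q) → ℝ) (x : V → Fin q) : ℝ :=
  ∑ v : V, (Fintype.card V : ℝ)⁻¹ *
    ∑ a : Fin q, condProb ν v x a * f (Function.update x v a)

/-- The Dirichlet form of the Glauber dynamics. -/
def dirichlet (ν : (V → Fin q) → ℝ) (f : (V → Fin q) → ℝ) : ℝ :=
  ∑ x, ν x * (f x * (f x - glauberAvg ν f x))

theorem sum_support (hν : ∀ x, 0 ≤ ν x) (F : (V → Fin q) → ℝ) :
    ∑ x : Support ν, ν x.1 * F x.1 = ∑ x, ν x * F x := by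
  rw [← Finset.sum_subtype (Finset.univ.filter fun x => 0 < ν x) (by simp)
    (fun x => ν x * F x)]
  refine Finset.sum_subset (Finset.filter_subset _ _) fun x _ hx => ?_
  have : ν x = 0 := le_antisymm (not_lt.1 fun h => hx (by simpa using h)) (hν x)
  rw [this, zero_mul]

theorem sum_condProb (hν : ∀ x, 0 ≤ ν x) (v : V) {x : V → Fin q} (hx : 0 < ν x) :
    ∑ a, condProb ν v x a = 1 := by
  unfold condProb
  rw [← Finset.sum_div]
  refine div_self (ne_of_gt ?_)
  refine Finset.sum_pos' (fun _ _ => hν _) ⟨x v, Finset.mem_univ _, ?_⟩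
  rwa [Function.update_eq_self]

theorem sum_glauber_mul (hν : ∀ x, 0 ≤ ν x) (f : (V → Fin q) → ℝ) (x : Support ν) :
    ∑ y : Support ν, glauber ν x y * f y.1 = glauberAvg ν f x.1 := by
  unfold glauber glauberAvg
  simp only [Finset.sum_mul, Finset.mul_sum]
  rw [Finset.sum_comm]
  refine Finset.sum_congr rfl fun v _ => ?_
  rw [Finset.sum_comm]
  refine Finset.sum_congr rfl fun a _ => ?_
  by_cases h : 0 < ν (Function.update x.1 v a)
  · rw [Finset.sum_eq_single ⟨Function.update x.1 v a, h⟩]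
    · simp [mul_assoc]
    · intro y _ hy
      rw [if_neg (fun h' => hy (Subtype.ext h'))]
      simp
    · exact fun h => absurd (Finset.mem_univ _) h
  · have h0 : condProb ν v x.1 a = 0 := by
      unfold condProb
      rw [le_antisymm (not_lt.1 h) (hν _), zero_div]
    simp [h0]

theorem sum_glauber (hν : ∀ x, 0 ≤ ν x) [Nonempty V] (x : Support ν) :
    ∑ y : Support ν, glauber ν x y = 1 := by
  have h := sum_glauber_mul hν (fun _ => 1) x
  simp only [mul_one, glauberAvg, sum_condProb hν _ x.2] at h
  rw [h]
  simp

theorem glauber_reversible (x y : Support ν) :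
    ν x.1 * glauber ν x y = ν y.1 * glauber ν y x := by
  have key : ∀ (x y : Support ν) (v : V),
      (∑ a : Fin q, if y.1 = Function.update x.1 v a then condProb ν v x.1 a else 0) =
        if ∀ w, w ≠ v → y.1 w = x.1 w then condProb ν v x.1 (y.1 v) else 0 := by
    intro x y v
    rw [Finset.sum_eq_single (y.1 v)]
    · congr 1
      rw [eq_iff_iff, Function.eq_update_iff]
      simp
    · intro a _ ha
      rw [if_neg]
      intro h
      exact ha (by rw [h, Function.update_self])
    · exact fun h => absurd (Finset.mem_univ _) h
  unfold glauber
  rw [Finset.mul_sum, Finset.mul_sum]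
  refine Finset.sum_congr rfl fun v _ => ?_
  rw [key, key]
  by_cases h : ∀ w, w ≠ v → y.1 w = x.1 w
  · have hu : ∀ a, Function.update y.1 v a = Function.update x.1 v a := fun a => by
      funext w
      by_cases hw : w = v
      · subst hw; simp
      · simp [hw, h w hw]
    rw [if_pos h, if_pos fun w hw => (h w hw).symm]
    unfold condProb
    simp only [hu]
    rw [Function.update_eq_self, ← hu (y.1 v), Function.update_eq_self]
    ring
  · rw [if_neg h, if_neg fun h' => h fun w hw => (h' w hw).symm]
    simp

theorem sq_sqrt_support (x : Support ν) : √(ν x.1) ^ 2 = ν x.1 := Real.sq_sqrt x.2.le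

theorem dirichlet_eq_sum_support (hν : ∀ x, 0 ≤ ν x) (f : (V → Fin q) → ℝ) :
    ∑ x : Support ν, √(ν x.1) ^ 2 * (f x.1 * (f x.1 - ∑ y, glauber ν x y * f y.1)) =
      dirichlet ν f := by
  simp only [sq_sqrt_support, sum_glauber_mul hν]
  exact sum_support hν fun x => f x * (f x - glauberAvg ν f x)

theorem exists_extension (f : Support ν → ℝ) :
    ∃ F : (V → Fin q) → ℝ, f = fun x => F x.1 :=
  ⟨fun x => if h : 0 < ν x then f ⟨x, h⟩ else 0, funext fun x => by simp [x.2]⟩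

/-- A finite relaxation time yields a Poincaré inequality. -/
theorem sum_sq_le_of_relaxationTime_le [Nonempty V] (hν : ∀ x, 0 ≤ ν x)
    (hpos : ∀ f, 0 ≤ dirichlet ν f) {T : ℝ} (hT : 0 < T)
    (h : relaxationTime ν ≤ ENNReal.ofReal T) {f : (V → Fin q) → ℝ}
    (hf : ∑ x, ν x * f x = 0) : ∑ x, ν x * f x ^ 2 ≤ T * dirichlet ν f := by
  have hgap : T⁻¹ ≤ 1 - secondEigenvalue (glauber ν) := by
    unfold relaxationTime at h
    rw [ENNReal.inv_le_iff_inv_le, ← ENNReal.ofReal_inv_of_pos hT] at h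
    exact (ENNReal.ofReal_le_ofReal_iff'.1 h).resolve_right (by simpa using hT)
  have key := one_sub_secondEigenvalue_mul_le (P := glauber ν) (s := fun x => √(ν x.1))
    (fun x => Real.sqrt_pos.2 x.2)
    (fun x y => by simp only [sq_sqrt_support]; exact glauber_reversible x y)
    (sum_glauber hν)
    (fun g => by
      obtain ⟨F, rfl⟩ := exists_extension g
      rw [dirichlet_eq_sum_support hν]
      exact hpos F)
    (f := fun x => f x.1)
    (by simp only [sq_sqrt_support]; rw [sum_support hν f]; exact hf)
  rw [dirichlet_eq_sum_support hν] at key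
  simp only [sq_sqrt_support] at key
  rw [sum_support hν fun x => f x ^ 2] at key
  have h2 : 0 ≤ ∑ x, ν x * f x ^ 2 :=
    Finset.sum_nonneg fun x _ => mul_nonneg (hν x) (sq_nonneg _)
  have h3 := (mul_le_mul_of_nonneg_right hgap h2).trans key
  rwa [inv_mul_le_iff₀ hT] at h3

/-- A Poincaré inequality bounds the relaxation time. -/
theorem relaxationTime_le_of_sum_sq_le (hν : ∀ x, 0 ≤ ν x) {T : ℝ} (hT : 1 ≤ T)
    (h : ∀ f : (V → Fin q) → ℝ, ∑ x, ν x * f x = 0 →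
      ∑ x, ν x * f x ^ 2 ≤ T * dirichlet ν f) :
    relaxationTime ν ≤ ENNReal.ofReal T := by
  have hT0 : 0 < T := by linarith
  have hgap : secondEigenvalue (glauber ν) ≤ 1 - T⁻¹ := by
    refine secondEigenvalue_le (P := glauber ν) (s := fun x => √(ν x.1))
      (fun x => Real.sqrt_pos.2 x.2)
      (fun x y => by simp only [sq_sqrt_support]; exact glauber_reversible x y)
      (sub_nonneg.2 (inv_le_one_of_one_le₀ hT)) fun g hg => ?_
    obtain ⟨F, rfl⟩ := exists_extension g
    simp only [sq_sqrt_support, sum_glauber_mul hν] at hg ⊢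
    rw [sum_support hν F] at hg
    rw [sum_support hν fun x => F x * glauberAvg ν F x, sum_support hν fun x => F x ^ 2]
    have h1 := h F hg
    rw [← inv_mul_le_iff₀ hT0] at h1
    have h2 : dirichlet ν F = ∑ x, ν x * F x ^ 2 - ∑ x, ν x * (F x * glauberAvg ν F x) := by
      rw [dirichlet, ← Finset.sum_sub_distrib]
      exact Finset.sum_congr rfl fun x _ => by ring
    linarith
  unfold relaxationTime
  rw [ENNReal.inv_le_iff_inv_le, ← ENNReal.ofReal_inv_of_pos hT0]
  exact ENNReal.ofReal_le_ofReal (by linarith)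

end Glauber

end Spin

end

noncomputable section

namespace Spin.SpinSystem

open Classical

variable {V : Type*} [Fintype V] {G : SimpleGraph V} {q : ℕ} {𝒮 : SpinSystem G q}

theorem avg_compl_singleton_eq_sum (v : V) (f : (V → Fin q) → ℝ) (y : V → Fin q) :
    𝒮.avg {v}ᶜ f y =
      ∑ a, 𝒮.kernel {v}ᶜ y (Function.update y v a) * f (Function.update y v a) := by
  have hinj : Function.Injective fun a : Fin q => Function.update y v a :=
    Function.update_injective y v
  unfold avg
  rw [← Finset.sum_image (s := Finset.univ) (g := fun a : Fin q => Function.update y v a)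
    (f := fun z => 𝒮.kernel {v}ᶜ y z * f z) hinj.injOn]
  symm
  refine Finset.sum_subset (Finset.subset_univ _) fun z _ hz => ?_
  have : 𝒮.kernel {v}ᶜ y z = 0 := by
    by_contra h
    refine hz (Finset.mem_image.2 ⟨z v, Finset.mem_univ _, ?_⟩)
    rw [Function.update_eq_iff]
    exact ⟨rfl, fun w hw => (eq_of_kernel_ne_zero h w (by simpa using hw)).symm⟩
  rw [this, zero_mul]

theorem condProb_kernel_eq (h : 𝒮.WellDefined) {S : Finset V} {x y : V → Fin q}
    (hy : 0 < 𝒮.kernel S x y) {v : V} (hv : v ∉ S) (a : Fin q) :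
    condProb (𝒮.kernel S x) v y a = 𝒮.kernel {v}ᶜ y (Function.update y v a) := by
  have hS : S ⊆ {v}ᶜ := fun w hw => by
    simp only [Finset.mem_compl, Finset.mem_singleton]
    rintro rfl
    exact hv hw
  have h1 : ∀ b, 𝒮.kernel S x (Function.update y v b) * 𝒮.kernel {v}ᶜ y y =
      𝒮.kernel S x y * 𝒮.kernel {v}ᶜ y (Function.update y v b) := fun b => by
    rw [kernel_mul_kernel_comm hS x y, kernel_congr (x := Function.update y v b) (y := y)]
    intro w hw
    rw [Function.update_of_ne (by simpa using hw)]
  have h2 : ∑ b, 𝒮.kernel {v}ᶜ y (Function.update y v b) = 1 := by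
    have := avg_compl_singleton_eq_sum (𝒮 := 𝒮) v (fun _ => 1) y
    rw [avg_const h] at this
    simpa using this.symm
  have h3 : (∑ b, 𝒮.kernel S x (Function.update y v b)) * 𝒮.kernel {v}ᶜ y y =
      𝒮.kernel S x y := by
    rw [Finset.sum_mul, Finset.sum_congr rfl fun b _ => h1 b, ← Finset.mul_sum, h2, mul_one]
  have h4 : (∑ b, 𝒮.kernel S x (Function.update y v b)) ≠ 0 := fun h0 => by
    rw [h0, zero_mul] at h3
    exact hy.ne h3
  have h5 : 𝒮.kernel {v}ᶜ y y ≠ 0 := fun h0 => by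
    rw [h0, mul_zero] at h3
    exact hy.ne h3
  unfold condProb
  rw [div_eq_iff h4]
  refine mul_right_cancel₀ h5 ?_
  rw [h1, mul_assoc, h3, mul_comm]

theorem sum_condProb_kernel_of_mem {S : Finset V} {x y : V → Fin q}
    (hy : 0 < 𝒮.kernel S x y) {v : V} (hv : v ∈ S) (f : (V → Fin q) → ℝ) :
    ∑ a, condProb (𝒮.kernel S x) v y a * f (Function.update y v a) = f y := by
  have h0 : ∀ a, a ≠ y v → condProb (𝒮.kernel S x) v y a = 0 := fun a ha => by
    unfold condProb
    rw [show 𝒮.kernel S x (Function.update y v a) = 0 by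
      by_contra hne
      apply ha
      have h1 := eq_of_kernel_ne_zero hne v hv
      rw [Function.update_self] at h1
      rw [h1, eq_of_kernel_ne_zero hy.ne' v hv], zero_div]
  have h1 := sum_condProb (ν := 𝒮.kernel S x) (kernel_nonneg S x) v hy
  rw [Finset.sum_eq_single (y v) (fun a _ ha => h0 a ha) (by simp)] at h1
  rw [Finset.sum_eq_single (y v) (fun a _ ha => by rw [h0 a ha, zero_mul]) (by simp), h1,
    Function.update_eq_self, one_mul]

theorem glauberAvg_kernel [Nonempty V] (h : 𝒮.WellDefined) {S : Finset V} {x y : V → Fin q}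
    (hy : 0 < 𝒮.kernel S x y) (f : (V → Fin q) → ℝ) :
    f y - glauberAvg (𝒮.kernel S x) f y =
      (Fintype.card V : ℝ)⁻¹ * ∑ v ∈ Sᶜ, (f y - 𝒮.avg {v}ᶜ f y) := by
  have e : f y = ∑ _v : V, (Fintype.card V : ℝ)⁻¹ * f y := by simp
  unfold glauberAvg
  nth_rewrite 1 [e]
  rw [← Finset.sum_sub_distrib, Finset.mul_sum]
  symm
  rw [← Finset.sum_subset (Finset.subset_univ Sᶜ)]
  · refine Finset.sum_congr rfl fun v hv => ?_
    rw [avg_compl_singleton_eq_sum, ← mul_sub]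
    simp only [condProb_kernel_eq h hy (Finset.mem_compl.1 hv)]
  · intro v _ hv
    rw [sum_condProb_kernel_of_mem hy (by simpa using hv), sub_self]

theorem dirichlet_kernel [Nonempty V] (h : 𝒮.WellDefined) (S : Finset V) (x : V → Fin q)
    (f : (V → Fin q) → ℝ) :
    dirichlet (𝒮.kernel S x) f =
      (Fintype.card V : ℝ)⁻¹ * ∑ v ∈ Sᶜ, 𝒮.avg S (𝒮.var {v}ᶜ f) x := by
  have e1 : dirichlet (𝒮.kernel S x) f =
      𝒮.avg S (fun y => (Fintype.card V : ℝ)⁻¹ *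
        ∑ v ∈ Sᶜ, (f y ^ 2 - f y * 𝒮.avg {v}ᶜ f y)) x := by
    unfold dirichlet
    rw [avg]
    refine Finset.sum_congr rfl fun y _ => ?_
    rcases (kernel_nonneg (𝒮 := 𝒮) S x y).eq_or_lt with h0 | h0
    · simp [← h0]
    · rw [glauberAvg_kernel h h0, mul_left_comm (f y), Finset.mul_sum]
      simp only [mul_sub, sq]
  rw [e1, avg_const_mul, avg_sum]
  congr 1
  refine Finset.sum_congr rfl fun v hv => ?_
  have hS : S ⊆ {v}ᶜ := fun w hw => by
    simp only [Finset.mem_compl, Finset.mem_singleton]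
    rintro rfl
    exact (Finset.mem_compl.1 hv) hw
  rw [avg_sub, avg_mul_avg_self h hS, avg_var h hS]

theorem var_le_of_relaxationTime_le [Nonempty V] (h : 𝒮.WellDefined) {S : Finset V}
    {x : V → Fin q} {T : ℝ} (hT : 0 < T)
    (hrel : relaxationTime (𝒮.kernel S x) ≤ ENNReal.ofReal T) (f : (V → Fin q) → ℝ) :
    𝒮.var S f x ≤
      T * (Fintype.card V : ℝ)⁻¹ * ∑ v ∈ Sᶜ, 𝒮.avg S (𝒮.var {v}ᶜ f) x := by
  set g : (V → Fin q) → ℝ := fun y => f y - 𝒮.avg S f x with hg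
  have hg0 : 𝒮.avg S g x = 0 := by rw [hg, avg_sub, avg_const h, sub_self]
  have hvar : ∀ U, 𝒮.var U f = 𝒮.var U g := fun U => (var_sub_const h U f _).symm
  have hpos : ∀ f, 0 ≤ dirichlet (𝒮.kernel S x) f := fun f => by
    rw [dirichlet_kernel h]
    exact mul_nonneg (by positivity) (Finset.sum_nonneg fun v _ =>
      avg_nonneg _ _ fun y => var_nonneg h _ _ _)
  have key := sum_sq_le_of_relaxationTime_le (kernel_nonneg S x) hpos hT hrel (f := g) hg0
  rw [dirichlet_kernel h, ← mul_assoc] at key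
  simp only [hvar]
  refine le_trans (le_of_eq ?_) key
  rw [var, hg0]
  simp [avg]

theorem relaxationTime_le_of_var_le [Nonempty V] (h : 𝒮.WellDefined) {S : Finset V}
    {x : V → Fin q} {T : ℝ} (hT : 1 ≤ T)
    (hvar : ∀ f : (V → Fin q) → ℝ, 𝒮.var S f x ≤
      T * (Fintype.card V : ℝ)⁻¹ * ∑ v ∈ Sᶜ, 𝒮.avg S (𝒮.var {v}ᶜ f) x) :
    relaxationTime (𝒮.kernel S x) ≤ ENNReal.ofReal T := by
  refine relaxationTime_le_of_sum_sq_le (kernel_nonneg S x) hT fun f hf => ?_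
  rw [dirichlet_kernel h, ← mul_assoc]
  refine le_trans (le_of_eq ?_) (hvar f)
  have hf' : 𝒮.avg S f x = 0 := hf
  rw [var, hf']
  simp [avg]

theorem relaxationTime_kernel_univ (x : V → Fin q) :
    relaxationTime (𝒮.kernel Finset.univ x) = 1 := by
  have : Subsingleton (Support (𝒮.kernel Finset.univ x)) := ⟨fun y z => Subtype.ext (funext
    fun v => (eq_of_kernel_ne_zero y.2.ne' v (Finset.mem_univ v)).trans
      (eq_of_kernel_ne_zero z.2.ne' v (Finset.mem_univ v)).symm)⟩
  unfold relaxationTime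
  rw [secondEigenvalue_eq_of_card_le (Fintype.card_le_one_iff_subsingleton.2 this)]
  simp

theorem relaxationTime_kernel_le {η : ℝ} {S : Finset V} (hS : Sᶜ ∈ lowDegreeSets G η)
    (x : V → Fin q) : relaxationTime (𝒮.kernel S x) ≤ 𝒮.pinnedRelaxationTime η := by
  have h : relaxationTime (𝒮.kernel Sᶜᶜ x) ≤ 𝒮.pinnedRelaxationTime η := by
    unfold pinnedRelaxationTime
    exact le_iSup₂_of_le Sᶜ hS (le_iSup (fun τ : (Sᶜᶜ : Finset V) → Fin q =>
      relaxationTime (𝒮.pinned Sᶜᶜ τ)) fun v => x v)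
  rwa [compl_compl] at h

theorem one_le_pinnedRelaxationTime {η : ℝ} (hη : 0 ≤ η) (x : V → Fin q) :
    1 ≤ 𝒮.pinnedRelaxationTime η := by
  rw [← relaxationTime_kernel_univ (𝒮 := 𝒮) x]
  refine relaxationTime_kernel_le ?_ x
  have h0 : (G.induce {v | v ∈ (Finset.univ : Finset V)ᶜ}).maxDegree ≤ 0 :=
    SimpleGraph.maxDegree_le_of_forall_degree_le _ _ fun v => absurd v.2 (by simp)
  show ((G.induce {v | v ∈ (Finset.univ : Finset V)ᶜ}).maxDegree : ℝ) ≤ _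
  rw [Nat.le_zero.1 h0, Nat.cast_zero]
  positivity

theorem compl_outside_mem_lowDegreeSets {k : ℕ} {η : ℝ} {c : V → Fin k} {t : ℕ}
    (hc : ∀ v j, ((G.neighborFinset v).filter fun w => c w = j).card ≤ t) {I : Finset (Fin k)}
    (hI : (I.card * t : ℝ) ≤ η * G.maxDegree) : (outside c I)ᶜ ∈ lowDegreeSets G η := by
  show ((G.induce {v | v ∈ (outside c I)ᶜ}).maxDegree : ℝ) ≤ η * G.maxDegree
  refine le_trans ?_ hI
  rw [← Nat.cast_mul, Nat.cast_le]
  refine SimpleGraph.maxDegree_le_of_forall_degree_le _ _ fun v => ?_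
  rw [← SimpleGraph.card_neighborFinset_eq_degree]
  calc _ ≤ (I.biUnion fun i => (G.neighborFinset v.1).filter fun w => c w = i).card := by
        refine Finset.card_le_card_of_injOn Subtype.val (fun w hw => ?_)
          Subtype.val_injective.injOn
        have hw' : G.Adj v.1 w.1 := by simpa using hw
        have hcw : c w.1 ∈ I := by
          by_contra h
          exact (Finset.mem_compl.1 w.2) (mem_outside.2 h)
        simpa using ⟨hw', hcw⟩
    _ ≤ ∑ i ∈ I, t := Finset.card_biUnion_le.trans (Finset.sum_le_sum fun i _ => hc v.1 i)
    _ = _ := by simp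

/-- Comparison of relaxation times along a partition into `k` sparse parts. -/
theorem relaxationTime_gibbs_le [Nonempty V] (h : 𝒮.WellDefined) {C η : ℝ} (hC0 : 0 < C)
    (hη : 0 ≤ η) (hC : 𝒮.CouplingIndependent C) {k t R : ℕ} {c : V → Fin k}
    (hc : ∀ v j, ((G.neighborFinset v).filter fun w => c w = j).card ≤ t)
    (hCR : 2 * C ≤ R) (hRk : R ≤ k) (hRt : (R * t : ℝ) ≤ η * G.maxDegree) :
    relaxationTime 𝒮.gibbs ≤ ENNReal.ofReal (2 ^ (k - R)) * 𝒮.pinnedRelaxationTime η := by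
  obtain ⟨ρ, hC⟩ := hC
  obtain ⟨x, -, -⟩ := Finset.exists_ne_zero_of_sum_ne_zero
    (h ∅ fun v => absurd v.2 (Finset.notMem_empty _)).ne'
  have h1 := one_le_pinnedRelaxationTime (𝒮 := 𝒮) hη x
  by_cases htop : 𝒮.pinnedRelaxationTime η = ⊤
  · rw [htop, ENNReal.mul_top (by simp)]
    exact le_top
  set T := (𝒮.pinnedRelaxationTime η).toReal with hT
  have hTη : 𝒮.pinnedRelaxationTime η = ENNReal.ofReal T := (ENNReal.ofReal_toReal htop).symm
  have hT1 : 1 ≤ T := by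
    rw [hTη, ENNReal.one_le_ofReal] at h1
    exact h1
  have hout : outside c (Finset.univ : Finset (Fin k)) = ∅ := by
    ext v; simp [mem_outside]
  rw [hTη, ← ENNReal.ofReal_mul (by positivity), gibbs_eq_pinned fun v => x v]
  refine relaxationTime_le_of_var_le (S := ∅) (x := x) h
    (one_le_mul_of_one_le_of_one_le (one_le_pow₀ (by norm_num)) hT1) fun f => ?_
  have key := var_le_of_forall_card_eq h hC0 hC c hCR
    (T := T * (Fintype.card V : ℝ)⁻¹) f
    (fun I hI y => var_le_of_relaxationTime_le h (by linarith)
      (hTη ▸ relaxationTime_kernel_le (compl_outside_mem_lowDegreeSets hc (hI ▸ hRt)) y) f)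
    (by positivity) (k - R) Finset.univ (by rw [Finset.card_fin]; omega) x
  rw [hout, ← mul_assoc] at key
  exact key

end Spin.SpinSystem

end

theorem mainTheorem1 :
    ∃ c₀ c₁ : ℝ, 0 < c₀ ∧ 0 < c₁ ∧
      ∀ M η : ℝ, 1 ≤ M → 0 < η → η ≤ 1 / (2 * (⌈M⌉ : ℝ)) →
        ∀ (V : Type*) [Fintype V] (G : SimpleGraph V) [DecidableRel G.Adj]
          (q : ℕ) (𝒮 : Spin.SpinSystem G q),
          𝒮.WellDefined →
          c₀ * (M ^ 2 / η ^ 2 * Real.log (M / η)) ≤ (G.maxDegree : ℝ) →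
          𝒮.CouplingIndependent M →
          Spin.relaxationTime 𝒮.gibbs ≤
            ENNReal.ofReal ((2 : ℝ) ^ (c₁ * (M / η))) * 𝒮.pinnedRelaxationTime η := by
  classical
  refine ⟨200, 100, by norm_num, by norm_num, ?_⟩
  intro M η hM hη hηM V _ G _ q 𝒮 hwd hΔ hC
  obtain ⟨k, t, R, hkt, hk, hMR, hRk, hRt, hkM⟩ :=
    Spin.exists_partition_parameters hM hη hηM hΔ
  have hdeg : 0 < G.maxDegree := by
    have hηle : η ≤ 1 / 2 := hηM.trans (by
      have := Int.le_ceil M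
      rw [div_le_div_iff₀ (by linarith) (by norm_num)]; linarith)
    have hlog : 0 < Real.log (M / η) :=
      Real.log_pos ((one_lt_div hη).2 (by linarith))
    have : (0 : ℝ) < G.maxDegree := lt_of_lt_of_le (by positivity) hΔ
    exact_mod_cast this
  have hV : Nonempty V := by
    by_contra hV
    rw [not_nonempty_iff] at hV
    simp at hdeg
  obtain ⟨c, hc⟩ := Spin.exists_sparseColouring (G := G) (k := k) (t := t) hk
    (by convert hkt)
  refine (Spin.SpinSystem.relaxationTime_gibbs_le hwd (by linarith) hη.le hC hc hMR hRk
    (by convert hRt)).trans ?_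
  gcongr
  rw [← Real.rpow_natCast]
  refine Real.rpow_le_rpow_of_exponent_le (by norm_num) (le_trans ?_ hkM)
  exact_mod_cast Nat.sub_le k R
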